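/- Let $\mathcal O$ be a one-dimensional noetherian domain with field of fractions $K$ whose normalization $\tilde{\mathcal O}$ (the integral closure of $\mathcal O$ in $K$) is finitely generated as an $\mathcal O$-module. For a one-dimensional noetherian domain $A$ with field of fractions $K$ and a maximal ideal $\mathfrak p$ of $A$ let $\mathrm{ord}_{\mathfrak p}\colon K^*\to\mathbb Z$ be the homomorphism $a/b\mapsto \mathrm{len}_{A_{\mathfrak p}}(A_{\mathfrak p}/aA_{\mathfrak p})-\mathrm{len}_{A_{\mathfrak p}}(A_{\mathfrak p}/bA_{\mathfrak p})$ ($a,b\in A\setminus\{0\}$). Let $\mathrm{Div}(A)$ be the free abelian group on the maximal ideals of $A$, let $\mathrm{div}_A(a)=\sum_{\mathfrak p}\mathrm{ord}_{\mathfrak p}(a)\,\mathfrak p$ for $a\in K^*$, and let $\mathrm{Chow}(A)=\mathrm{Div}(A)/\mathrm{div}_A(K^*)$. Let $\mathrm{Pic}(A)$ be the group of invertible fractional ideals of $A$ modulo the principal ones; it is denoted $\mathrm{Cl}(A)$ if $A$ is normal. If $\mathfrak a$ is an invertible fractional ideal and $\mathfrak a_{\mathfrak p}=a_{\mathfrak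 p}A_{\mathfrak p}$ with $a_{\mathfrak p}\in K^*$, put $\mathrm{div}_A(\mathfrak a)=\sum_{\mathfrak p}\mathrm{ord}_{\mathfrak p}(a_{\mathfrak p})\,\mathfrak p$; this induces the canonical homomorphism $\overline{\mathrm{div}}_A\colon \mathrm{Pic}(A)\to\mathrm{Chow}(A)$. Let $f_*\colon\mathrm{Div}(\tilde{\mathcal O})\to\mathrm{Div}(\mathcal O)$ be the homomorphism with $f_*(\mathfrak P)=[\tilde{\mathcal O}/\mathfrak P:\mathcal O/(\mathfrak P\cap\mathcal O)]\cdot(\mathfrak P\cap\mathcal O)$, and let $\overline{f_*}\colon\mathrm{Chow}(\tilde{\mathcal O})\to\mathrm{Chow}(\mathcal O)$ be the homomorphism it induces. The canonical homomorphism $\mathrm{Pic}(\mathcal O)\to\mathrm{Cl}(\tilde{\mathcal O})$ is $[\mathfrak a]\mapsto[\mathfrak a\tilde{\mathcal O}]$. Then: 1. $\overline{\mathrm{div}}_{\mathcal O}\colon\mathrm{Pic}(\mathcal O)\to\mathrm{Chow}(\mathcal O)$ is surjective if and only if $\mathrm{Chow}(\mathcal O_{\mathfrak p})$ is trivial for every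 maximal ideal $\mathfrak p$ of $\mathcal O$. 2. $\overline{\mathrm{div}}_{\mathcal O}$ is injective if and only if $\mathrm{Pic}(\mathcal O)\to\mathrm{Cl}(\tilde{\mathcal O})$ is an isomorphism and $\ker(\overline{f_*})\subseteq\mathrm{Chow}(\tilde{\mathcal O})$ is trivial. Likewise, it is injective if and only if $\mathrm{Pic}(\mathcal O)\to\mathrm{Cl}(\tilde{\mathcal O})$ is an isomorphism and the image of $\ker(f_*)$ in $\mathrm{Chow}(\tilde{\mathcal O})$ is trivial. -/

import Mathlib

open scoped nonZeroDivisors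

noncomputable section

namespace ChowGroup

section Localization

variable {R : Type*} [CommRing R] [IsDomain R]
  {K : Type*} [Field K] [Algebra R K] [IsFractionRing R K]

instance dimensionLEOne_localization [Ring.DimensionLEOne R] (p : MaximalSpectrum R) :
    Ring.DimensionLEOne (Localization.AtPrime p.asIdeal) :=
  Ring.DimensionLEOne.localization (Localization.AtPrime p.asIdeal)
    p.asIdeal.primeCompl_le_nonZeroDivisors

theorem toPrincipalIdeal_surjective [IsLocalRing R] :
    Function.Surjective (toPrincipalIdeal R K) := by
  have h0 : Subsingleton (ClassGroup R) := (ClassGroup.equivPic R).toEquiv.subsingleton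
  have h1 : Subsingleton ((FractionalIdeal R⁰ K)ˣ ⧸ (toPrincipalIdeal R K).range) :=
    (ClassGroup.equiv K).symm.toEquiv.subsingleton
  intro I
  have h : (QuotientGroup.mk 1 : (FractionalIdeal R⁰ K)ˣ ⧸ (toPrincipalIdeal R K).range) =
    QuotientGroup.mk I := Subsingleton.elim _ _
  rw [QuotientGroup.eq] at h
  obtain ⟨x, hx⟩ := h
  exact ⟨x, by rw [hx]; simp⟩

end Localization

section Ord

variable (R : Type*) [CommRing R] [IsDomain R] [IsNoetherianRing R] [Ring.DimensionLEOne R]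
  (K : Type*) [Field K] [Algebra R K] [IsFractionRing R K]

/-- The homomorphism `K* → ℤ`, `a / b ↦ length (R / a R) - length (R / b R)`, with values written
multiplicatively. -/
def ordHom : Kˣ →* Multiplicative ℤ :=
  (WithZero.unitsWithZeroEquiv (α := Multiplicative ℤ)).toMonoidHom.comp
    (Units.map (Ring.ordFrac R : K →*₀ WithZero (Multiplicative ℤ)).toMonoidHom)

variable {R K}

theorem ordHom_eq {a : R} (x : Kˣ) (hx : (x : K) = algebraMap R _ a) :
    ((ordHom R K x).toAdd : ℤ) = ((Module.length R (R ⧸ Ideal.span {a})).toNat : ℤ) := by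
  have ha : a ≠ 0 := by
    rintro rfl
    exact x.ne_zero (by rw [hx, map_zero])
  have ha' : a ∈ R⁰ := mem_nonZeroDivisors_of_ne_zero ha
  have h1 : ((ordHom R K x : Multiplicative ℤ) : WithZero (Multiplicative ℤ)) =
      Ring.ordFrac R (x : K) := by
    simp only [ordHom, MonoidHom.comp_apply]
    exact WithZero.coe_unitsWithZeroEquiv_eq_units_val _
  rw [hx, Ring.ordFrac_eq_ord R ha, Ring.ordMonoidWithZeroHom_eq_coe R ha'
    (n := (Module.length R (R ⧸ Ideal.span {a})).toNat)
    (ENat.natCast_toNat (Ring.ord_ne_top ha')).symm] at h1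
  rw [WithZero.coe_inj] at h1
  rw [h1]
  rfl

theorem ordHom_eq_one_of_isUnit {a : R} (ha : IsUnit a) (x : Kˣ)
    (hx : (x : K) = algebraMap R _ a) : ordHom R K x = 1 := by
  have h := ordHom_eq x hx
  have : Subsingleton (R ⧸ Ideal.span {a}) := by
    rw [Ideal.span_singleton_eq_top.mpr ha]
    exact Ideal.Quotient.subsingleton_iff.mpr rfl
  rw [Module.length_eq_zero] at h
  exact Multiplicative.toAdd.injective (by simpa using h)

theorem ker_toPrincipalIdeal_le :
    (toPrincipalIdeal R K).ker ≤ (ordHom R K).ker := by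
  intro x hx
  rw [MonoidHom.mem_ker, toPrincipalIdeal_eq_iff] at hx
  rw [MonoidHom.mem_ker]
  have hx1 : FractionalIdeal.spanSingleton R⁰ (x : K) = 1 := by simpa using hx
  have h1 : (x : K) ∈ (1 : FractionalIdeal R⁰ K) := by
    rw [← hx1]; exact FractionalIdeal.mem_spanSingleton_self _ _
  obtain ⟨a, ha⟩ := (FractionalIdeal.mem_one_iff R⁰).mp h1
  have h2 : (1 : K) ∈ FractionalIdeal.spanSingleton R⁰ (x : K) := by
    rw [hx1]; exact FractionalIdeal.one_mem_one _
  obtain ⟨b, hb⟩ := (FractionalIdeal.mem_spanSingleton R⁰).mp h2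
  refine ordHom_eq_one_of_isUnit (a := a) ?_ x ha.symm
  refine IsUnit.of_mul_eq_one b (IsFractionRing.injective R K ?_)
  rw [map_mul, ha, map_one, mul_comm, ← Algebra.smul_def, hb]

/-- Over a local ring every invertible fractional ideal is principal. This is the unique
homomorphism on invertible fractional ideals with `a R ↦ ord a` for all `a ∈ K*`. -/
def ordIdealHom [IsLocalRing R] :
    (FractionalIdeal R⁰ K)ˣ →* Multiplicative ℤ :=
  MonoidHom.liftOfSurjective (toPrincipalIdeal R K) toPrincipalIdeal_surjective
    ⟨ordHom R K, ker_toPrincipalIdeal_le⟩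

theorem ordIdealHom_toPrincipalIdeal [IsLocalRing R] (x : Kˣ) :
    ordIdealHom (toPrincipalIdeal R K x) = ordHom R K x :=
  MonoidHom.liftOfRightInverse_comp_apply _ _ _ _ _

end Ord

section Div

variable {R : Type*} [CommRing R] [IsDomain R]

/-- The localization `𝔞 ↦ 𝔞_p = 𝔞 R_p` of invertible fractional ideals. -/
def localize (p : MaximalSpectrum R) :
    (FractionalIdeal R⁰ (FractionRing R))ˣ →*
      (FractionalIdeal (Localization.AtPrime p.asIdeal)⁰ (FractionRing R))ˣ :=
  Units.map (FractionalIdeal.extendedHom (FractionRing R)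
    (Localization.AtPrime p.asIdeal)).toMonoidHom

theorem fractionRing_map_eq (p : MaximalSpectrum R) (x : FractionRing R) :
    IsFractionRing.map (K := FractionRing R) (L := FractionRing R)
      (FaithfulSMul.algebraMap_injective R (Localization.AtPrime p.asIdeal)) x = x := by
  have : (IsFractionRing.map (K := FractionRing R) (L := FractionRing R)
      (FaithfulSMul.algebraMap_injective R (Localization.AtPrime p.asIdeal))) =
      RingHom.id (FractionRing R) := by
    apply IsLocalization.ringHom_ext R⁰
    ext r
    simp only [RingHom.comp_apply, RingHom.id_apply]
    rw [IsFractionRing.map, IsLocalization.map_eq, ← IsScalarTower.algebraMap_apply]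
  rw [this, RingHom.id_apply]

variable [IsNoetherianRing R] [Ring.DimensionLEOne R]

/-- `ord_p : K* → ℤ`, `a / b ↦ length (R_p / a R_p) - length (R_p / b R_p)`, where `K`, the field of
fractions of `R`, is also the field of fractions of `R_p`. -/
def ord (p : MaximalSpectrum R) : (FractionRing R)ˣ →* Multiplicative ℤ :=
  ordHom (Localization.AtPrime p.asIdeal) (FractionRing R)

/-- `ord_p(𝔞) = ord_p(a_p)`, where `𝔞_p = a_p R_p`. -/
def ordIdeal (p : MaximalSpectrum R) :
    (FractionalIdeal R⁰ (FractionRing R))ˣ →* Multiplicative ℤ :=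
  ordIdealHom.comp (localize p)

theorem ordIdeal_toPrincipalIdeal (p : MaximalSpectrum R) (x : (FractionRing R)ˣ) :
    ordIdeal p (toPrincipalIdeal R (FractionRing R) x) = ord p x := by
  rw [ordIdeal, ord, MonoidHom.comp_apply, ← ordIdealHom_toPrincipalIdeal]
  congr 1
  ext1
  simp only [localize, Units.coe_map, coe_toPrincipalIdeal]
  refine (FractionalIdeal.extendedHom_spanSingleton _ _ _).trans ?_
  rw [fractionRing_map_eq]

theorem finite_setOf_mem {R : Type*} [CommRing R] [IsNoetherianRing R] [Ring.DimensionLEOne R]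
    {a : R} (ha : a ≠ 0) :
    {p : MaximalSpectrum R | a ∈ p.asIdeal}.Finite := by
  have h := Ideal.finite_minimalPrimes_of_isNoetherianRing R (Ideal.span {a})
  refine Set.Finite.of_injOn (f := MaximalSpectrum.asIdeal) ?_
    (fun p _ q _ h => MaximalSpectrum.ext h) h
  intro p hp
  have hp' : a ∈ p.asIdeal := hp
  refine ⟨⟨p.isMaximal.isPrime, by simpa using hp'⟩, fun q hq hqp => ?_⟩
  have hq0 : q ≠ ⊥ := by
    rintro rfl
    exact ha (by simpa using hq.2)
  exact ((hq.1.isMaximal hq0).eq_of_le p.isMaximal.ne_top hqp).ge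

theorem ordIdeal_eq_one {I : (FractionalIdeal R⁰ (FractionRing R))ˣ} {s a : R}
    {p : MaximalSpectrum R}
    (hs : ∀ x ∈ (I : FractionalIdeal R⁰ (FractionRing R)), ∃ y : R,
      algebraMap R _ y = algebraMap R _ s * x)
    (ha : algebraMap R (FractionRing R) a ∈ (I : FractionalIdeal R⁰ (FractionRing R)))
    (hsp : s ∉ p.asIdeal) (hap : a ∉ p.asIdeal) : ordIdeal p I = 1 := by
  have : localize p I = 1 := by
    ext1
    obtain ⟨u, hu⟩ : IsUnit (algebraMap R (Localization.AtPrime p.asIdeal) s) :=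
      IsLocalization.map_units (M := p.asIdeal.primeCompl) _ ⟨s, hsp⟩
    obtain ⟨v, hv⟩ : IsUnit (algebraMap R (Localization.AtPrime p.asIdeal) a) :=
      IsLocalization.map_units (M := p.asIdeal.primeCompl) _ ⟨a, hap⟩
    simp only [localize, Units.coe_map, Units.val_one]
    have hmem : ∀ x : FractionRing R,
        x ∈ FractionalIdeal.extendedHom (FractionRing R) (Localization.AtPrime p.asIdeal) I.val ↔
        x ∈ Submodule.span (Localization.AtPrime p.asIdeal)
          ((I : FractionalIdeal R⁰ (FractionRing R)) : Set (FractionRing R)) := by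
      intro x
      refine (FractionalIdeal.mem_extended_iff _ _ _ x).trans ?_
      rw [show (IsLocalization.map (FractionRing R) (algebraMap R (Localization.AtPrime p.asIdeal))
        _ '' ((I : FractionalIdeal R⁰ (FractionRing R)) : Set (FractionRing R))) =
          ((I : FractionalIdeal R⁰ (FractionRing R)) : Set (FractionRing R)) from
          (Set.image_congr fun y _ => fractionRing_map_eq p y).trans (Set.image_id' _)]
    apply le_antisymm
    · intro x hx
      refine Submodule.span_le (p := ((1 : FractionalIdeal (Localization.AtPrime p.asIdeal)⁰
        (FractionRing R)) : Submodule _ _)).mpr ?_ ((hmem x).mp hx)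
      intro z hz
      obtain ⟨y, hy⟩ := hs z hz
      refine (FractionalIdeal.mem_one_iff _).mpr ⟨↑u⁻¹ * algebraMap R _ y, ?_⟩
      rw [map_mul, ← IsScalarTower.algebraMap_apply, hy, IsScalarTower.algebraMap_apply R
        (Localization.AtPrime p.asIdeal), ← hu, ← mul_assoc, ← map_mul, Units.inv_mul, map_one,
        one_mul]
    · refine FractionalIdeal.one_le.mpr ((hmem 1).mpr ?_)
      have h2 := Submodule.smul_mem _ (↑v⁻¹ : Localization.AtPrime p.asIdeal)
        (Submodule.subset_span (R := Localization.AtPrime p.asIdeal) ha)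
      rwa [IsScalarTower.algebraMap_apply R (Localization.AtPrime p.asIdeal) (FractionRing R),
        ← hv, Algebra.smul_def, ← map_mul, Units.inv_mul, map_one] at h2
  rw [ordIdeal, MonoidHom.comp_apply, this, map_one]

theorem finite_support_ordIdeal (I : (FractionalIdeal R⁰ (FractionRing R))ˣ) :
    (Function.support fun p : MaximalSpectrum R => (ordIdeal p I).toAdd).Finite := by
  obtain ⟨s, hs0, hs⟩ := (I : FractionalIdeal R⁰ (FractionRing R)).isFractional
  obtain ⟨a, ha0, ha⟩ := FractionalIdeal.exists_ne_zero_mem_isInteger (I := I.val) I.ne_zero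
  have hs0' : s ≠ 0 := nonZeroDivisors.ne_zero hs0
  refine ((finite_setOf_mem hs0').union (finite_setOf_mem ha0)).subset ?_
  intro p hp
  by_contra hcon
  simp only [Set.mem_union, Set.mem_ofPred_eq, not_or] at hcon
  refine hp ?_
  have := ordIdeal_eq_one (I := I) (s := s) (a := a) (p := p) (fun x hx => ?_) ha hcon.1 hcon.2
  · simp [this]
  · obtain ⟨y, hy⟩ := hs x hx
    exact ⟨y, by rw [hy, Algebra.smul_def]⟩

theorem finite_support_ord (x : (FractionRing R)ˣ) :
    (Function.support fun p : MaximalSpectrum R => (ord p x).toAdd).Finite := by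
  have := finite_support_ordIdeal (toPrincipalIdeal R (FractionRing R) x)
  simpa only [ordIdeal_toPrincipalIdeal] using this

/-- The group of divisors: the free abelian group on the maximal ideals of `R`. -/
abbrev Divisor (R : Type*) [CommRing R] : Type _ := MaximalSpectrum R →₀ ℤ

variable (R)

/-- `div : K* → Div(R)`, `a ↦ ∑ ord_p(a) p`. -/
def divisor : Additive (FractionRing R)ˣ →+ Divisor R where
  toFun x := Finsupp.ofSupportFinite (fun p => (ord p x.toMul).toAdd) (finite_support_ord _)
  map_zero' := by ext p; simp [Finsupp.ofSupportFinite_coe]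
  map_add' x y := by ext p; simp [Finsupp.ofSupportFinite_coe]

/-- `div : I(R) → Div(R)`, `𝔞 ↦ ∑ ord_p(𝔞) p`, on the group of invertible fractional ideals. -/
def divisorIdeal : Additive (FractionalIdeal R⁰ (FractionRing R))ˣ →+ Divisor R where
  toFun I := Finsupp.ofSupportFinite (fun p => (ordIdeal p I.toMul).toAdd)
    (finite_support_ordIdeal _)
  map_zero' := by ext p; simp [Finsupp.ofSupportFinite_coe]
  map_add' x y := by ext p; simp [Finsupp.ofSupportFinite_coe]

theorem divisor_apply (x : (FractionRing R)ˣ) (p : MaximalSpectrum R) :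
    divisor R (Additive.ofMul x) p = (ord p x).toAdd := rfl

theorem divisorIdeal_toPrincipalIdeal (x : (FractionRing R)ˣ) :
    divisorIdeal R (Additive.ofMul (toPrincipalIdeal R (FractionRing R) x)) =
      divisor R (Additive.ofMul x) := by
  ext p
  exact congrArg Multiplicative.toAdd (ordIdeal_toPrincipalIdeal p x)

/-- The principal divisors. -/
def principalDivisors : AddSubgroup (Divisor R) := (divisor R).range

/-- The Chow group: divisors modulo principal divisors. -/
abbrev Chow : Type _ := Divisor R ⧸ principalDivisors R

/-- The homomorphism `Pic(R) → Chow(R)`, `[𝔞] ↦ [div 𝔞]`, where `ClassGroup R` is the group of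
invertible fractional ideals modulo principal ones. -/
def picToChow : Additive (ClassGroup R) →+ Chow R :=
  MonoidHom.toAdditiveLeft <| QuotientGroup.lift (toPrincipalIdeal R (FractionRing R)).range
    (AddMonoidHom.toMultiplicativeRight
      ((QuotientAddGroup.mk' (principalDivisors R)).comp (divisorIdeal R))) <| by
    rintro _ ⟨x, rfl⟩
    refine Multiplicative.toAdd.injective ?_
    change (QuotientAddGroup.mk' (principalDivisors R)) (divisorIdeal R (Additive.ofMul _)) = 0
    rw [divisorIdeal_toPrincipalIdeal]
    exact (QuotientAddGroup.eq_zero_iff _).mpr ⟨_, rfl⟩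

theorem picToChow_mk (I : (FractionalIdeal R⁰ (FractionRing R))ˣ) :
    picToChow R (Additive.ofMul (ClassGroup.mk (FractionRing R) I)) =
      (divisorIdeal R (Additive.ofMul I) : Chow R) := by
  rw [← ClassGroup.Quot_mk_eq_mk]
  rfl

end Div

section Length

/-- The length over `R_p` of the localization `M_p`. -/
def locLength {R : Type*} [CommRing R] (p : MaximalSpectrum R) (M : Type*) [AddCommGroup M]
    [Module R M] : ℕ∞ :=
  Module.length (Localization.AtPrime p.asIdeal) (LocalizedModule p.asIdeal.primeCompl M)

section

variable {R : Type*} [CommRing R] (p : MaximalSpectrum R) {M N P : Type*} [AddCommGroup M]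
  [Module R M] [AddCommGroup N] [Module R N] [AddCommGroup P] [Module R P]

theorem locLength_add {f : M →ₗ[R] N} {g : N →ₗ[R] P} (hf : Function.Injective f)
    (hg : Function.Surjective g) (h : Function.Exact f g) :
    locLength p N = locLength p M + locLength p P :=
  Module.length_eq_add_of_exact (LocalizedModule.map p.asIdeal.primeCompl f)
    (LocalizedModule.map p.asIdeal.primeCompl g)
    (LocalizedModule.map_injective _ f hf) (LocalizedModule.map_surjective _ g hg)
    (LocalizedModule.map_exact p.asIdeal.primeCompl f g h)

theorem locLength_le {f : M →ₗ[R] N} (hf : Function.Injective f) :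
    locLength p M ≤ locLength p N := by
  rw [locLength_add p hf (Submodule.mkQ_surjective _) (LinearMap.exact_map_mkQ_range f)]
  exact le_self_add

theorem locLength_eq_of_isLocalizedModule {M' : Type*} [AddCommGroup M'] [Module R M']
    [Module (Localization.AtPrime p.asIdeal) M']
    [IsScalarTower R (Localization.AtPrime p.asIdeal) M'] (f : M →ₗ[R] M')
    [IsLocalizedModule p.asIdeal.primeCompl f] :
    locLength p M = Module.length (Localization.AtPrime p.asIdeal) M' :=
  ((IsLocalizedModule.iso p.asIdeal.primeCompl f).extendScalarsOfIsLocalization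
    p.asIdeal.primeCompl (Localization.AtPrime p.asIdeal)).length_eq

theorem locLength_congr (e : M ≃ₗ[R] N) : locLength p M = locLength p N := by
  have h := locLength_add p (f := e.toLinearMap) (g := (0 : N →ₗ[R] PUnit.{1})) e.injective
    (fun x => ⟨0, rfl⟩) (fun y => by simp)
  have h0 : locLength p PUnit.{1} = 0 := Module.length_eq_zero
  rw [h, h0, add_zero]

theorem locLength_eq_zero_of_subsingleton [Subsingleton M] : locLength p M = 0 :=
  Module.length_eq_zero

theorem locLength_eq_zero {s : R} (hs : s ∉ p.asIdeal) (h : ∀ m : M, s • m = 0) :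
    locLength p M = 0 := by
  have : Subsingleton (LocalizedModule p.asIdeal.primeCompl M) :=
    LocalizedModule.subsingleton_iff.mpr fun m => ⟨s, hs, h m⟩
  exact Module.length_eq_zero

theorem locLength_quotient (a : R) :
    Module.length (Localization.AtPrime p.asIdeal) (Localization.AtPrime p.asIdeal ⧸
      Ideal.span {algebraMap R (Localization.AtPrime p.asIdeal) a}) =
      locLength p (R ⧸ Ideal.span {a}) := by
  have h : Submodule.localized' (Localization.AtPrime p.asIdeal) p.asIdeal.primeCompl
      (Algebra.linearMap R (Localization.AtPrime p.asIdeal)) (Ideal.span {a}) =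
      Ideal.span {algebraMap R (Localization.AtPrime p.asIdeal) a} := by
    refine (Submodule.localized'_span _ _ _ _).trans ?_
    rw [Set.image_singleton]
    rfl
  rw [← h]
  exact (locLength_eq_of_isLocalizedModule p (Submodule.toLocalizedQuotient'
    (Localization.AtPrime p.asIdeal) p.asIdeal.primeCompl
    (Algebra.linearMap R (Localization.AtPrime p.asIdeal)) (Ideal.span {a}))).symm

end

section Ord

variable {R : Type*} [CommRing R] [IsDomain R] [IsNoetherianRing R] [Ring.DimensionLEOne R]

theorem ord_eq_locLength (p : MaximalSpectrum R) {a : R} (x : (FractionRing R)ˣ)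
    (hx : (x : FractionRing R) = algebraMap R _ a) :
    ((ord p x).toAdd : ℤ) = ((locLength p (R ⧸ Ideal.span {a})).toNat : ℤ) := by
  rw [← locLength_quotient]
  refine ordHom_eq x ?_
  rw [hx, ← IsScalarTower.algebraMap_apply]

theorem locLength_ne_top (p : MaximalSpectrum R) {a : R} (ha : a ≠ 0) :
    locLength p (R ⧸ Ideal.span {a}) ≠ ⊤ := by
  rw [← locLength_quotient]
  refine Ring.ord_ne_top (mem_nonZeroDivisors_of_ne_zero ?_)
  rw [Ne, IsLocalization.to_map_eq_zero_iff _ p.asIdeal.primeCompl_le_nonZeroDivisors]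
  exact ha

end Ord

section Tower

variable {A B : Type*} [CommRing A] [CommRing B] [Algebra A B] [Algebra.IsIntegral A B]

/-- The map `P ↦ P ∩ A` on maximal ideals. -/
def under (A : Type*) {B : Type*} [CommRing A] [CommRing B] [Algebra A B] [Algebra.IsIntegral A B]
    (P : MaximalSpectrum B) : MaximalSpectrum A :=
  ⟨P.asIdeal.under A, Ideal.isMaximal_comap_of_isIntegral_of_isMaximal P.asIdeal⟩

theorem isLocalizedModule_id {R M : Type*} [CommRing R] [AddCommGroup M] [Module R M]
    (S : Submonoid R) (h : ∀ s ∈ S, Function.Bijective fun m : M => s • m) :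
    IsLocalizedModule S (LinearMap.id : M →ₗ[R] M) where
  map_units s := (Module.End.isUnit_iff _).mpr (h s s.2)
  surj m := ⟨(m, 1), by simp⟩
  exists_of_eq {m n} e := ⟨1, by simpa using e⟩

theorem bijective_smul {R M : Type*} [CommRing R] [AddCommGroup M] [Module R M] {s t : R}
    (h : ∀ m : M, (t * s) • m = m) : Function.Bijective fun m : M => s • m :=
  Function.bijective_iff_has_inverse.mpr ⟨fun m => t • m, fun m => by
    simpa [smul_smul] using h m, fun m => by simpa [smul_smul, mul_comm] using h m⟩

theorem exists_mul_smul_eq {R M : Type*} [CommRing R] [AddCommGroup M] [Module R M]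
    (P : MaximalSpectrum R) (hM : ∀ s ∈ P.asIdeal, ∀ m : M, s • m = 0) {s : R}
    (hs : s ∉ P.asIdeal) : ∃ t, ∀ m : M, (t * s) • m = m := by
  obtain ⟨t, ht⟩ := P.isMaximal.exists_inv hs
  obtain ⟨i, hi, h⟩ := ht
  refine ⟨t, fun m => ?_⟩
  have := congrArg (· • m) h
  simpa [add_smul, hM i hi] using this

theorem locLength_tower_aux {M : Type*} [AddCommGroup M] [Module A M] [Module B M]
    [IsScalarTower A B M] (P : MaximalSpectrum B)
    (hdeg : P.asIdeal.inertiaDeg A ≠ 0)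
    (hM : ∀ s ∈ P.asIdeal, ∀ m : M, s • m = 0) :
    locLength (under A P) M = P.asIdeal.inertiaDeg A * locLength P M := by
  let p := under A P
  have : P.asIdeal.LiesOver p.asIdeal := ⟨rfl⟩
  let := Localization.AtPrime.algebraOfLiesOver p.asIdeal P.asIdeal
  let M' := LocalizedModule P.asIdeal.primeCompl M
  let : Module (Localization.AtPrime p.asIdeal) M' :=
    Module.compHom M' (algebraMap (Localization.AtPrime p.asIdeal)
      (Localization.AtPrime P.asIdeal))
  have : IsScalarTower (Localization.AtPrime p.asIdeal) (Localization.AtPrime P.asIdeal) M' :=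
    IsScalarTower.of_compHom ..
  have : IsScalarTower A (Localization.AtPrime p.asIdeal) M' := by
    refine IsScalarTower.of_algebraMap_smul fun a m => ?_
    rw [← algebraMap_smul (Localization.AtPrime P.asIdeal)
      (algebraMap A (Localization.AtPrime p.asIdeal) a) m, ← IsScalarTower.algebraMap_apply,
      IsScalarTower.algebraMap_apply A B, algebraMap_smul, algebraMap_smul]
  have hbijB : ∀ s ∈ P.asIdeal.primeCompl, Function.Bijective fun m : M => s • m := fun s hs =>
    have ⟨t, ht⟩ := exists_mul_smul_eq P hM hs
    bijective_smul ht
  have hB := isLocalizedModule_id _ hbijB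
  let e : M' ≃ₗ[B] M := IsLocalizedModule.iso P.asIdeal.primeCompl (LinearMap.id : M →ₗ[B] M)
  have hA : IsLocalizedModule p.asIdeal.primeCompl (LinearMap.id : M →ₗ[A] M) := by
    refine isLocalizedModule_id _ fun s hs => ?_
    have := hbijB (algebraMap A B s) hs
    simpa only [algebraMap_smul] using this
  have hA' : IsLocalizedModule p.asIdeal.primeCompl ((e.symm.restrictScalars A).toLinearMap ∘ₗ
      (LinearMap.id : M →ₗ[A] M)) := inferInstance
  rw [locLength_eq_of_isLocalizedModule p ((e.symm.restrictScalars A).toLinearMap ∘ₗ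
      (LinearMap.id : M →ₗ[A] M)),
    IsLocalRing.length_restrictScalars (Localization.AtPrime p.asIdeal)
      (Localization.AtPrime P.asIdeal) M', mul_comm]
  congr 1
  have hd := Ideal.inertiaDeg_eq p.asIdeal P.asIdeal
  have : Module.Finite (IsLocalRing.ResidueField (Localization.AtPrime p.asIdeal))
      (IsLocalRing.ResidueField (Localization.AtPrime P.asIdeal)) :=
    Module.finite_of_finrank_pos (Nat.pos_of_ne_zero (by rw [hd] at hdeg; exact hdeg))
  rw [Module.length_eq_finrank, hd]

theorem locLength_tower (p : MaximalSpectrum A) (T : Finset (MaximalSpectrum B))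
    (hdeg : ∀ P : MaximalSpectrum B, P.asIdeal.inertiaDeg A ≠ 0)
    (hT : ∀ P ∈ T, under A P = p) {M : Type*} [AddCommGroup M] [Module B M]
    (hM : IsFiniteLength B M) : ∀ [Module A M] [IsScalarTower A B M]
    (_ : ∀ P : MaximalSpectrum B, under A P = p → P ∉ T → locLength P M = 0),
    locLength p M = ∑ P ∈ T, P.asIdeal.inertiaDeg A * locLength P M := by
  classical
  induction hM with
  | of_subsingleton => intros; simp [locLength_eq_zero_of_subsingleton]
  | @of_simple_quotient M _ _ N hS hN ih =>
    intro _ _ hTM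
    have hadd : ∀ P : MaximalSpectrum B, locLength P M = locLength P N + locLength P (M ⧸ N) :=
      fun P => locLength_add P N.subtype_injective N.mkQ_surjective
        (LinearMap.exact_subtype_mkQ N)
    have hadd' : locLength p M = locLength p N + locLength p (M ⧸ N) :=
      locLength_add p (f := N.subtype.restrictScalars A) (g := N.mkQ.restrictScalars A)
        N.subtype_injective N.mkQ_surjective (LinearMap.exact_subtype_mkQ N)
    rw [hadd', ih fun P h1 h2 => by have := hTM P h1 h2; rw [hadd] at this; simp_all]
    simp only [hadd, mul_add, Finset.sum_add_distrib]
    congr 1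
    obtain ⟨m, hm, ⟨e⟩⟩ := isSimpleModule_iff_quot_maximal.mp hS
    let Q : MaximalSpectrum B := ⟨m, hm⟩
    have hQ : ∀ s ∈ Q.asIdeal, ∀ x : M ⧸ N, s • x = 0 := by
      intro s hs x
      apply e.injective
      rw [map_smul, map_zero]
      obtain ⟨y, hy⟩ := Ideal.Quotient.mk_surjective (e x)
      rw [← hy, Algebra.smul_def, Ideal.Quotient.algebraMap_eq, ← map_mul,
        Ideal.Quotient.eq_zero_iff_mem]
      exact m.mul_mem_right _ hs
    have hzero : ∀ P : MaximalSpectrum B, P ≠ Q → locLength P (M ⧸ N) = 0 := by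
      intro P hPQ
      obtain ⟨s, hs, hsP⟩ : ∃ s ∈ Q.asIdeal, s ∉ P.asIdeal := by
        by_contra! hcon
        exact hPQ (MaximalSpectrum.ext (Q.isMaximal.eq_of_le P.isMaximal.ne_top hcon).symm)
      exact locLength_eq_zero P hsP (hQ s hs)
    by_cases hQp : under A Q = p
    · rw [← hQp, locLength_tower_aux Q (hdeg Q) hQ]
      by_cases hQT : Q ∈ T
      · rw [Finset.sum_eq_single_of_mem Q hQT fun P _ hP => by rw [hzero P hP, mul_zero]]
      · have h0 := hTM Q hQp hQT
        rw [hadd, add_eq_zero] at h0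
        rw [h0.2, mul_zero, Finset.sum_eq_zero]
        intro P hP
        rw [hzero P (fun h => hQT (h ▸ hP)), mul_zero]
    · rw [Finset.sum_eq_zero fun P hP => by
        rw [hzero P (fun h => hQp (h ▸ hT P hP)), mul_zero]]
      obtain ⟨s, hs, hsp⟩ : ∃ s ∈ (under A Q).asIdeal, s ∉ p.asIdeal := by
        by_contra! hcon
        exact hQp (MaximalSpectrum.ext
          ((under A Q).isMaximal.eq_of_le p.isMaximal.ne_top hcon))
      refine locLength_eq_zero p hsp fun x => ?_
      rw [← algebraMap_smul B s x]
      exact hQ _ hs x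

end Tower

end Length

section Pushforward

variable (A B : Type*) [CommRing A] [CommRing B] [Algebra A B]

/-- The push-forward `f_* : Div(B) → Div(A)`, `P ↦ [B / P : A / (P ∩ A)] (P ∩ A)`, the
degree of the residue fields being `Ideal.inertiaDeg`. -/
def pushforward [Algebra.IsIntegral A B] : Divisor B →+ Divisor A :=
  Finsupp.liftAddHom fun P => (Finsupp.singleAddHom (under A P)).comp
    (AddMonoidHom.mulLeft (P.asIdeal.inertiaDeg A : ℤ))

theorem pushforward_apply [Algebra.IsIntegral A B] (D : Divisor B) (p : MaximalSpectrum A)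
    [DecidableEq (MaximalSpectrum A)] :
    pushforward A B D p = ∑ P ∈ D.support with under A P = p,
      (P.asIdeal.inertiaDeg A : ℤ) * D P := by
  simp only [pushforward, Finsupp.liftAddHom_apply, Finsupp.sum, Finsupp.finsetSum_apply,
    AddMonoidHom.comp_apply, Finsupp.singleAddHom_apply, AddMonoidHom.coe_mulLeft,
    Finsupp.single_apply, Finset.sum_filter]

variable {A B}
variable [IsDomain A] [IsDomain B] [IsNoetherianRing A] [Ring.DimensionLEOne A]

theorem locLength_quotient_eq (hinj : Function.Injective (algebraMap A B)) {d : A} (hd0 : d ≠ 0)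
    (hd : ∀ b : B, ∃ c : A, algebraMap A B c = algebraMap A B d * b)
    (p : MaximalSpectrum A) {a : A} (ha : a ≠ 0) :
    locLength p (A ⧸ Ideal.span {a}) = locLength p (B ⧸ Ideal.span {algebraMap A B a}) := by
  let ι : A →ₗ[A] B := Algebra.linearMap A B
  let J : Submodule A B := Submodule.map ι (Ideal.span {a})
  let I : Submodule A B := LinearMap.range ι
  let K : Submodule A B := (Ideal.span {algebraMap A B a}).restrictScalars A
  have ha' : algebraMap A B a ≠ 0 := by simpa using hinj.ne ha
  have hmemJ : ∀ b : B, b ∈ J ↔ ∃ c, algebraMap A B (a * c) = b := by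
    intro b
    simp only [J, Submodule.mem_map, Ideal.mem_span_singleton', ι, Algebra.linearMap_apply]
    constructor
    · rintro ⟨_, ⟨c, rfl⟩, rfl⟩
      exact ⟨c, by rw [mul_comm]⟩
    · rintro ⟨c, rfl⟩
      exact ⟨_, ⟨c, rfl⟩, by rw [mul_comm]⟩
  have hmemK : ∀ b : B, b ∈ K ↔ ∃ c, algebraMap A B a * c = b := by
    intro b
    simp only [K, Submodule.restrictScalars_mem, Ideal.mem_span_singleton']
    exact ⟨fun ⟨c, h⟩ => ⟨c, by rw [mul_comm, h]⟩, fun ⟨c, h⟩ => ⟨c, by rw [mul_comm, h]⟩⟩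
  have hJI : J ≤ I := LinearMap.map_le_range
  have hJK : J ≤ K := fun b hb => by
    obtain ⟨c, rfl⟩ := (hmemJ b).mp hb
    exact (hmemK _).mpr ⟨algebraMap A B c, by rw [map_mul]⟩
  let m : B →ₗ[A] B := LinearMap.lsmul A B a
  have hm : ∀ b, m b = algebraMap A B a * b := fun b => Algebra.smul_def _ _
  let f₁ : (A ⧸ Ideal.span {a}) →ₗ[A] B ⧸ J :=
    Submodule.mapQ _ _ ι (Submodule.le_comap_map _ _)
  let g₁ : (B ⧸ J) →ₗ[A] B ⧸ I := Submodule.factor hJI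
  let f₂ : (B ⧸ I) →ₗ[A] B ⧸ J := Submodule.mapQ _ _ m (by
    rintro _ ⟨c, rfl⟩
    rw [Submodule.mem_comap, hmemJ, hm]
    exact ⟨c, map_mul _ _ _⟩)
  let g₂ : (B ⧸ J) →ₗ[A] B ⧸ K := Submodule.factor hJK
  have hf₁ : Function.Injective f₁ := by
    rw [← LinearMap.ker_eq_bot, LinearMap.ker_eq_bot']
    intro x hx
    obtain ⟨x, rfl⟩ := Submodule.mkQ_surjective _ x
    have h : ι x ∈ J := (Submodule.Quotient.mk_eq_zero J).mp hx
    obtain ⟨c, hc⟩ := (hmemJ _).mp h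
    refine (Submodule.Quotient.mk_eq_zero _).mpr (Ideal.mem_span_singleton'.mpr ⟨c, ?_⟩)
    rw [mul_comm]
    exact hinj hc
  have hg₁ : Function.Surjective g₁ := Submodule.factor_surjective hJI
  have he₁ : Function.Exact f₁ g₁ := by
    intro y
    obtain ⟨y, rfl⟩ := Submodule.mkQ_surjective _ y
    constructor
    · intro h
      obtain ⟨x, rfl⟩ : y ∈ I := (Submodule.Quotient.mk_eq_zero I).mp h
      exact ⟨Submodule.mkQ _ x, rfl⟩
    · rintro ⟨x, hx⟩
      obtain ⟨x, rfl⟩ := Submodule.mkQ_surjective _ x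
      rw [← hx]
      exact (Submodule.Quotient.mk_eq_zero I).mpr ⟨x, rfl⟩
  have hf₂ : Function.Injective f₂ := by
    rw [← LinearMap.ker_eq_bot, LinearMap.ker_eq_bot']
    intro x hx
    obtain ⟨x, rfl⟩ := Submodule.mkQ_surjective _ x
    have h : m x ∈ J := (Submodule.Quotient.mk_eq_zero J).mp hx
    obtain ⟨c, hc⟩ := (hmemJ _).mp h
    rw [hm, map_mul] at hc
    exact (Submodule.Quotient.mk_eq_zero _).mpr ⟨c, mul_left_cancel₀ ha' hc⟩
  have hg₂ : Function.Surjective g₂ := Submodule.factor_surjective hJK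
  have he₂ : Function.Exact f₂ g₂ := by
    intro y
    obtain ⟨y, rfl⟩ := Submodule.mkQ_surjective _ y
    constructor
    · intro h
      obtain ⟨c, rfl⟩ := (hmemK y).mp ((Submodule.Quotient.mk_eq_zero K).mp h)
      exact ⟨Submodule.mkQ _ c, congrArg (Submodule.mkQ J) (hm c)⟩
    · rintro ⟨x, hx⟩
      obtain ⟨x, rfl⟩ := Submodule.mkQ_surjective _ x
      rw [← hx]
      exact (Submodule.Quotient.mk_eq_zero K).mpr ((hmemK _).mpr ⟨x, (hm x).symm⟩)
  have hI : locLength p (B ⧸ I) ≠ ⊤ := by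
    let m' : B →ₗ[A] B := LinearMap.lsmul A B d
    have hm' : ∀ b, m' b = algebraMap A B d * b := fun b => Algebra.smul_def _ _
    have hι : Function.Injective ι := hinj
    have hrange : ∀ b, m' b ∈ LinearMap.range ι := fun b => by
      obtain ⟨c, hc⟩ := hd b
      exact ⟨c, by rw [hm', ← hc]; rfl⟩
    let h : B →ₗ[A] A := (LinearEquiv.ofInjective ι hι).symm.toLinearMap ∘ₗ m'.codRestrict _ hrange
    have hh : ∀ b, algebraMap A B (h b) = algebraMap A B d * b := by
      intro b
      rw [← hm']
      exact congrArg Subtype.val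
        ((LinearEquiv.ofInjective ι hι).apply_symm_apply (m'.codRestrict _ hrange b))
    let k : (B ⧸ I) →ₗ[A] A ⧸ Ideal.span {d} := Submodule.mapQ I (Ideal.span {d}) h (by
      rintro _ ⟨c, rfl⟩
      rw [Submodule.mem_comap, Ideal.mem_span_singleton']
      refine ⟨c, hinj ?_⟩
      rw [hh, map_mul, mul_comm]
      rfl)
    have hk : Function.Injective k := by
      rw [← LinearMap.ker_eq_bot, LinearMap.ker_eq_bot']
      intro x hx
      obtain ⟨x, rfl⟩ := Submodule.mkQ_surjective _ x
      obtain ⟨c, hc⟩ := Ideal.mem_span_singleton'.mp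
        ((Submodule.Quotient.mk_eq_zero (Ideal.span {d})).mp hx)
      have h2 := congrArg (algebraMap A B) hc
      rw [hh, map_mul, mul_comm] at h2
      exact (Submodule.Quotient.mk_eq_zero _).mpr
        ⟨c, mul_left_cancel₀ (by simpa using hinj.ne hd0) h2⟩
    exact ne_top_of_le_ne_top (locLength_ne_top p hd0) (locLength_le p hk)
  have h1 := locLength_add p hf₁ hg₁ he₁
  have h2 := locLength_add p hf₂ hg₂ he₂
  rw [h1, add_comm (locLength p (B ⧸ I))] at h2
  have h3 : locLength p (A ⧸ Ideal.span {a}) = locLength p (B ⧸ K) :=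
    WithTop.add_right_cancel hI h2
  rw [h3]
  exact locLength_congr p (Submodule.Quotient.restrictScalarsEquiv A _)

variable [IsNoetherianRing B] [Ring.DimensionLEOne B] [Module.Finite A B]

theorem pushforward_divisor_algebraMap (hinj : Function.Injective (algebraMap A B)) {d : A}
    (hd0 : d ≠ 0) (hd : ∀ b : B, ∃ c : A, algebraMap A B c = algebraMap A B d * b) {a : A}
    (x : (FractionRing A)ˣ) (y : (FractionRing B)ˣ)
    (hx : (x : FractionRing A) = algebraMap A _ a)
    (hy : (y : FractionRing B) = algebraMap B _ (algebraMap A B a)) :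
    pushforward A B (divisor B (Additive.ofMul y)) = divisor A (Additive.ofMul x) := by
  classical
  have ha : a ≠ 0 := by
    rintro rfl
    exact x.ne_zero (by rw [hx, map_zero])
  have ha' : algebraMap A B a ≠ 0 := by simpa using hinj.ne ha
  ext p
  rw [pushforward_apply, divisor_apply, ord_eq_locLength p x hx,
    locLength_quotient_eq hinj hd0 hd p ha]
  have hfin : IsFiniteLength B (B ⧸ Ideal.span {algebraMap A B a}) :=
    isFiniteLength_quotient_span_singleton B (mem_nonZeroDivisors_of_ne_zero ha')
  rw [locLength_tower p {P ∈ (divisor B (Additive.ofMul y)).support | under A P = p}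
    (fun P => (Ideal.inertiaDeg_pos P.asIdeal A).ne') (fun P hP => (Finset.mem_filter.mp hP).2)
    hfin]
  · have hne : ∀ P : MaximalSpectrum B, ((P.asIdeal.inertiaDeg A : ℕ) : ℕ∞) *
        locLength P (B ⧸ Ideal.span {algebraMap A B a}) ≠ ⊤ := fun P =>
      WithTop.mul_ne_top (ENat.natCast_ne_top _) (locLength_ne_top P ha')
    rw [ENat.toNat_sum fun P _ => hne P]
    push_cast
    refine Finset.sum_congr rfl fun P _ => ?_
    rw [ENat.toNat_mul, divisor_apply, ord_eq_locLength P y hy]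
    simp
  · intro P hP hPT
    have h0 : divisor B (Additive.ofMul y) P = 0 := by
      by_contra hcon
      exact hPT (Finset.mem_filter.mpr ⟨Finsupp.mem_support_iff.mpr hcon, hP⟩)
    rw [divisor_apply, ord_eq_locLength P y hy, Nat.cast_eq_zero, ENat.toNat_eq_zero] at h0
    exact h0.resolve_right (locLength_ne_top P ha')

theorem pushforward_principal (hinj : Function.Injective (algebraMap A B)) {d : A}
    (hd0 : d ≠ 0) (hd : ∀ b : B, ∃ c : A, algebraMap A B c = algebraMap A B d * b) :
    principalDivisors B ≤ (principalDivisors A).comap (pushforward A B) := by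
  have hint : ∀ b : B, ∀ y : (FractionRing B)ˣ, (y : FractionRing B) = algebraMap B _ b →
      pushforward A B (divisor B (Additive.ofMul y)) ∈ principalDivisors A := by
    intro b y hy
    have hmk : ∀ c : A, c ≠ 0 → ∃ x : (FractionRing A)ˣ, ∃ z : (FractionRing B)ˣ,
        (x : FractionRing A) = algebraMap A _ c ∧
        (z : FractionRing B) = algebraMap B _ (algebraMap A B c) := by
      intro c hc
      refine ⟨Units.mk0 (algebraMap A _ c) ?_, Units.mk0 (algebraMap B _ (algebraMap A B c)) ?_,
        rfl, rfl⟩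
      · simpa using hc
      · simpa using hinj.ne hc
    obtain ⟨c, hc⟩ := hd b
    have hb : b ≠ 0 := by
      rintro rfl
      exact y.ne_zero (by rw [hy, map_zero])
    have hc0 : c ≠ 0 := by
      rintro rfl
      rw [map_zero, eq_comm, mul_eq_zero] at hc
      exact hc.elim (by simpa using hinj.ne hd0) hb
    obtain ⟨x₁, z₁, hx₁, hz₁⟩ := hmk c hc0
    obtain ⟨x₂, z₂, hx₂, hz₂⟩ := hmk d hd0
    have hyz : y = z₁ / z₂ := by
      rw [eq_div_iff_mul_eq']
      ext1
      rw [Units.val_mul, hy, hz₁, hz₂, hc, map_mul, mul_comm]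
    rw [hyz, ofMul_div, map_sub, map_sub, pushforward_divisor_algebraMap hinj hd0 hd x₁ z₁ hx₁ hz₁,
      pushforward_divisor_algebraMap hinj hd0 hd x₂ z₂ hx₂ hz₂, ← map_sub]
    exact ⟨_, rfl⟩
  rintro _ ⟨y, rfl⟩
  obtain ⟨b, c, hc, hbc⟩ := IsFractionRing.div_surjective (A := B)
    (y.toMul : FractionRing B)
  have hc0 : algebraMap B (FractionRing B) c ≠ 0 := by
    simpa using nonZeroDivisors.ne_zero hc
  have hb0 : algebraMap B (FractionRing B) b ≠ 0 := by
    intro h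
    rw [h, zero_div] at hbc
    exact y.toMul.ne_zero hbc.symm
  have hy : y = Additive.ofMul (Units.mk0 _ hb0 / Units.mk0 _ hc0) := by
    refine Additive.toMul.injective (Units.ext ?_)
    rw [← hbc]
    simp
  rw [hy, AddSubgroup.mem_comap, ofMul_div, map_sub, map_sub]
  exact sub_mem (hint b _ rfl) (hint c _ rfl)

end Pushforward

section Normalization

variable (O : Type*) [CommRing O] [IsDomain O]

/-- The normalization: the integral closure of `O` in its field of fractions. -/
abbrev Normalization : Type _ := integralClosure O (FractionRing O)

variable [Module.Finite O (Normalization O)]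

theorem exists_conductor : ∃ d : O, d ≠ 0 ∧ ∀ b : Normalization O, ∃ c : O,
    algebraMap O (Normalization O) c = algebraMap O (Normalization O) d * b := by
  classical
  obtain ⟨S, hS⟩ := Module.Finite.fg_top (R := O) (M := Normalization O)
  obtain ⟨d, hd⟩ := IsLocalization.exist_integer_multiples_of_finset O⁰
    (S.image (algebraMap (Normalization O) (FractionRing O)))
  refine ⟨d, nonZeroDivisors.ne_zero d.2, fun b => ?_⟩
  have hb : b ∈ Submodule.span O (S : Set (Normalization O)) := hS ▸ Submodule.mem_top
  induction hb using Submodule.span_induction with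
  | mem x hx =>
    obtain ⟨c, hc⟩ := hd _ (Finset.mem_image_of_mem _ hx)
    refine ⟨c, Subtype.ext ?_⟩
    refine hc.trans ?_
    rw [Algebra.smul_def]
    rfl
  | zero => exact ⟨0, by simp⟩
  | add x y _ _ hx hy =>
    obtain ⟨c, hc⟩ := hx
    obtain ⟨c', hc'⟩ := hy
    exact ⟨c + c', by rw [map_add, hc, hc', mul_add]⟩
  | smul r x _ hx =>
    obtain ⟨c, hc⟩ := hx
    exact ⟨r * c, by rw [map_mul, hc, Algebra.smul_def]; ring⟩

variable [IsNoetherianRing O] [Ring.DimensionLEOne O]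

instance isNoetherianRing_normalization : IsNoetherianRing (Normalization O) :=
  have : IsNoetherian O (Normalization O) := isNoetherian_of_isNoetherianRing_of_finite O _
  isNoetherian_of_tower O this

/-- The homomorphism `Chow(Õ) → Chow(O)` induced by the push-forward of divisors. -/
def pushforwardChow : Chow (Normalization O) →+ Chow O :=
  QuotientAddGroup.map (principalDivisors (Normalization O)) (principalDivisors O)
    (pushforward O (Normalization O)) <| by
    obtain ⟨d, hd0, hd⟩ := exists_conductor O
    exact pushforward_principal (FaithfulSMul.algebraMap_injective _ _) hd0 hd

end Normalization

end ChowGroup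

end

/-! Surjectivity is a local question. At `p` an invertible ideal has a generator in `K*`, so its
order lies in `ord_p(K*)`. Conversely, `(a)` factors as `I * J` with `I` outside every maximal ideal
other than `p` and `J` not inside `p` (`exists_mul_eq_span`). Both factors are invertible because
their product is, and `div I = ord_p(a) p`. Hence `picToChow` is onto exactly when every `ord_p` is
onto. Since `O_p` has a single maximal ideal, this says that `Chow(O_p)` is trivial.

Injectivity comes from factoring `picToChow O` as extension of ideals to the normalization, then
`picToChow` of the normalization, then `pushforwardChow` (`picToChow_eq_pushforwardChow`). The
middle map is bijective because the normalization is Dedekind (`picToChow_bijective`). The first is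
always surjective (`extendedHom_surjective`): with `d ≠ 0` such that `d Õ ⊆ O`, each class of `Õ`
has a representative coprime to `d`, whose contraction to `O` is invertible and extends back to it.
So the composite is injective if and only if both outer maps are.

The two forms of the kernel condition agree because push-forward takes `div_Õ(x)` to `div_O(x)`: a
divisor with principal push-forward can be corrected by a principal divisor to one with zero
push-forward (`ker_pushforwardChow`). -/

noncomputable section

namespace ChowGroup

/-! ### Primary components of principal ideals -/

section PrimaryComponent

variable {R : Type*} [CommRing R]

/-- The product of the multipliers chosen for finitely many generators is a common one. It turns an
inclusion of localizations at `p` into one given by a single denominator. -/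
theorem exists_notMem_forall_smul_mem {M : Type*} [AddCommGroup M] [Module R M] {p : Ideal R}
    [p.IsPrime] {N P : Submodule R M} (hN : N.FG) (h : ∀ x ∈ N, ∃ s ∉ p, s • x ∈ P) :
    ∃ s ∉ p, ∀ x ∈ N, s • x ∈ P := by
  obtain ⟨S, rfl⟩ := hN
  choose! f hf hfP using h
  refine ⟨∏ x ∈ S, f x, ?_, fun x hx => ?_⟩
  · exact prod_mem (S := p.primeCompl) fun x hx => hf x (Submodule.subset_span hx)
  · induction hx using Submodule.span_induction with
    | mem x hx =>
      obtain ⟨c, hc⟩ := Finset.dvd_prod_of_mem f (Finset.mem_coe.mp hx)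
      rw [hc, mul_comm, mul_smul]
      exact P.smul_mem _ (hfP x (Submodule.subset_span hx))
    | zero => simp
    | add x y _ _ hx hy => rw [smul_add]; exact P.add_mem hx hy
    | smul r x _ hx => rw [smul_comm]; exact P.smul_mem _ hx

/-- In a one-dimensional noetherian domain a principal ideal is the product of its `p`-primary
component and an ideal prime to `p`. -/
theorem exists_mul_eq_span [IsDomain R] [IsNoetherianRing R] [Ring.DimensionLEOne R]
    (p : MaximalSpectrum R) {a : R} (ha : a ≠ 0) :
    ∃ I J : Ideal R, I * J = Ideal.span {a} ∧ (∀ q : MaximalSpectrum R, q ≠ p → ¬ I ≤ q.asIdeal) ∧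
      ¬ J ≤ p.asIdeal := by
  -- The candidates are the contraction of `a R_p` and its colon `(a) : I`.
  let I : Ideal R := ((Ideal.span {a}).map
    (algebraMap R (Localization.AtPrime p.asIdeal))).comap (algebraMap R _)
  have hI : ∀ x, x ∈ I ↔ ∃ s ∈ p.asIdeal.primeCompl, s * x ∈ Ideal.span {a} := fun x =>
    IsLocalization.algebraMap_mem_map_algebraMap_iff p.asIdeal.primeCompl _ _ _
  let J : Ideal R := (Ideal.span {a}).colon I
  have hJ : ∀ x, x ∈ J ↔ ∀ y ∈ I, x * y ∈ Ideal.span {a} := fun x => Submodule.mem_colon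
  have hJp : ¬ J ≤ p.asIdeal := by
    obtain ⟨s, hs, h⟩ := exists_notMem_forall_smul_mem (p := p.asIdeal) (IsNoetherian.noetherian I)
      fun x hx => (hI x).mp hx
    exact fun hle => hs (hle ((hJ s).mpr h))
  have hIq : ∀ q : MaximalSpectrum R, q ≠ p → ¬ I ≤ q.asIdeal := by
    intro q hqp hle
    obtain ⟨t, htq, htp⟩ : ∃ t ∈ q.asIdeal, t ∉ p.asIdeal := by
      by_contra! hcon
      exact hqp (MaximalSpectrum.ext (q.isMaximal.eq_of_le p.isMaximal.ne_top hcon))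
    -- In the artinian module `R / (a)` the powers of `t` stabilize, so `t ^ n (1 - t y) ∈ (a)`. As
    -- `t ∉ p`, this puts `1 - t y` in `I`; with `t ∈ q`, the inclusion `I ≤ q` would give `1 ∈ q`.
    have : IsArtinian R (R ⧸ Ideal.span {a}) :=
      (isFiniteLength_iff_isNoetherian_isArtinian.mp
        (isFiniteLength_quotient_span_singleton R (mem_nonZeroDivisors_of_ne_zero ha))).2
    obtain ⟨n, y, hy⟩ := IsArtinian.exists_pow_succ_smul_dvd t (1 : R ⧸ Ideal.span {a})
    obtain ⟨y, rfl⟩ := Ideal.Quotient.mk_surjective y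
    have h1 : t ^ n * (1 - t * y) ∈ Ideal.span {a} := by
      rw [← Ideal.Quotient.eq_zero_iff_mem, mul_sub, map_sub, sub_eq_zero, ← mul_assoc, ← pow_succ]
      simpa [Algebra.smul_def] using hy.symm
    have h2 : 1 - t * y ∈ q.asIdeal :=
      hle ((hI _).mpr ⟨t ^ n, p.asIdeal.primeCompl.pow_mem htp n, h1⟩)
    exact q.isMaximal.ne_top (q.asIdeal.eq_top_of_isUnit_mem
      (by simpa using q.asIdeal.add_mem h2 (q.asIdeal.mul_mem_right y htq)) isUnit_one)
  have hcop : I ⊔ J = ⊤ := by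
    by_contra hcon
    obtain ⟨m, hm, hle⟩ := Ideal.exists_le_maximal _ hcon
    by_cases hmp : (⟨m, hm⟩ : MaximalSpectrum R) = p
    · subst hmp
      exact hJp (le_sup_right.trans hle)
    · exact hIq _ hmp (le_sup_left.trans hle)
  refine ⟨I, J, le_antisymm ?_ ?_, hIq, hJp⟩
  · rw [Ideal.mul_le]
    intro x hx y hy
    rw [mul_comm]
    exact (hJ y).mp hy x hx
  -- Coprimality makes the product an intersection, and both ideals contain `a`.
  · rw [Ideal.mul_eq_inf_of_isCoprime (Ideal.isCoprime_iff_sup_eq.mpr hcop), le_inf_iff]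
    refine ⟨Ideal.le_comap_map, fun x hx => (hJ x).mpr fun y _ => Ideal.mul_mem_right _ _ hx⟩

end PrimaryComponent

/-! ### Representatives of classes and local generators -/

section FractionalIdeal

variable {R : Type*} [CommRing R] [IsDomain R]

theorem mk_surjective : Function.Surjective (ClassGroup.mk (R := R) (FractionRing R)) := fun c => by
  obtain ⟨I, rfl⟩ := QuotientGroup.mk_surjective c
  exact ⟨I, (ClassGroup.Quot_mk_eq_mk I).symm⟩

theorem exists_units_eq_div (x : (FractionRing R)ˣ) : ∃ a b : R, a ≠ 0 ∧ b ≠ 0 ∧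
    ∃ y z : (FractionRing R)ˣ, (y : FractionRing R) = algebraMap R _ a ∧
      (z : FractionRing R) = algebraMap R _ b ∧ x = y / z := by
  obtain ⟨a, b, hb, hab⟩ := IsFractionRing.div_surjective (A := R) (x : FractionRing R)
  have hb0 : b ≠ 0 := nonZeroDivisors.ne_zero hb
  have ha0 : a ≠ 0 := by
    rintro rfl
    exact x.ne_zero (by rw [← hab, map_zero, zero_div])
  refine ⟨a, b, ha0, hb0, Units.mk0 (algebraMap R _ a) (by simpa), Units.mk0 (algebraMap R _ b)
    (by simpa), rfl, rfl, Units.ext ?_⟩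
  rw [← hab]
  simp

/-- Invertible ideals of the local ring `R_p` are principal, and a generator already lies in the
fraction field of `R`. -/
theorem exists_localize_eq (p : MaximalSpectrum R)
    (I : (FractionalIdeal R⁰ (FractionRing R))ˣ) :
    ∃ x : (FractionRing R)ˣ, localize p I = localize p (toPrincipalIdeal R _ x) := by
  obtain ⟨x, hx⟩ := toPrincipalIdeal_surjective (localize p I)
  refine ⟨x, ?_⟩
  rw [← hx]
  ext1
  simp only [localize, Units.coe_map, coe_toPrincipalIdeal]
  refine ((FractionalIdeal.extendedHom_spanSingleton _ _ _).trans ?_).symm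
  rw [fractionRing_map_eq]

end FractionalIdeal

/-! ### Invertible ideals with divisor supported at one prime -/

section SingleDivisor

variable {R : Type*} [CommRing R] [IsDomain R] [IsNoetherianRing R] [Ring.DimensionLEOne R]

theorem ordIdeal_eq_one_of_coeIdeal {I : (FractionalIdeal R⁰ (FractionRing R))ˣ} {J : Ideal R}
    (hI : (I : FractionalIdeal R⁰ (FractionRing R)) = J) {p : MaximalSpectrum R}
    (hJ : ¬ J ≤ p.asIdeal) : ordIdeal p I = 1 := by
  obtain ⟨a, ha, hap⟩ := SetLike.not_le_iff_exists.mp hJ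
  refine ordIdeal_eq_one (s := 1) (a := a) (fun x hx => ?_) ?_
    (p.asIdeal.ne_top_iff_one.mp p.isMaximal.ne_top) hap
  · rw [hI] at hx
    obtain ⟨y, _, rfl⟩ := (FractionalIdeal.mem_coeIdeal R⁰).mp hx
    exact ⟨y, by simp⟩
  · rw [hI]
    exact FractionalIdeal.mem_coeIdeal_of_mem R⁰ ha

theorem divisorIdeal_apply (I : (FractionalIdeal R⁰ (FractionRing R))ˣ) (p : MaximalSpectrum R) :
    divisorIdeal R (Additive.ofMul I) p = (ordIdeal p I).toAdd := rfl

/-- For integral `x` take the factor of the principal ideal belonging to `p`: it divides an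
invertible ideal, so it is invertible, and the cofactor contributes nothing at `p`. Fractions follow
by division. -/
theorem exists_divisorIdeal_eq_single (p : MaximalSpectrum R) (x : (FractionRing R)ˣ) :
    ∃ I : (FractionalIdeal R⁰ (FractionRing R))ˣ,
      divisorIdeal R (Additive.ofMul I) = Finsupp.single p (ord p x).toAdd := by
  classical
  have hint : ∀ (a : R) (y : (FractionRing R)ˣ), a ≠ 0 → (y : FractionRing R) = algebraMap R _ a →
      ∃ I : (FractionalIdeal R⁰ (FractionRing R))ˣ,
        divisorIdeal R (Additive.ofMul I) = Finsupp.single p (ord p y).toAdd := by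
    intro a y ha hy
    obtain ⟨I, J, hIJ, hI, hJ⟩ := exists_mul_eq_span p ha
    have hmul : (I : FractionalIdeal R⁰ (FractionRing R)) * J = toPrincipalIdeal R _ y := by
      rw [coe_toPrincipalIdeal, hy, ← FractionalIdeal.coeIdeal_mul, hIJ,
        FractionalIdeal.coeIdeal_span_singleton]
    have hu : IsUnit ((I : FractionalIdeal R⁰ (FractionRing R)) * J) := hmul ▸ Units.isUnit _
    obtain ⟨u, hu'⟩ := isUnit_of_mul_isUnit_left hu
    obtain ⟨v, hv'⟩ := isUnit_of_mul_isUnit_right hu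
    have huv : u * v = toPrincipalIdeal R _ y := Units.ext (by rw [Units.val_mul, hu', hv', hmul])
    refine ⟨u, Finsupp.ext fun q => ?_⟩
    rw [divisorIdeal_apply, Finsupp.single_apply]
    split_ifs with hq
    · subst hq
      rw [← ordIdeal_toPrincipalIdeal, ← huv, map_mul, ordIdeal_eq_one_of_coeIdeal hv' hJ, mul_one]
    · rw [ordIdeal_eq_one_of_coeIdeal hu' (hI q (Ne.symm hq)), toAdd_one]
  obtain ⟨a, b, ha, hb, y, z, hy, hz, rfl⟩ := exists_units_eq_div x
  obtain ⟨I, hI⟩ := hint a y ha hy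
  obtain ⟨J, hJ⟩ := hint b z hb hz
  refine ⟨I / J, ?_⟩
  rw [ofMul_div, map_sub, hI, hJ, map_div, toAdd_div, Finsupp.single_sub]

end SingleDivisor

/-! ### Chow groups of the localizations and the surjectivity criterion -/

section LocalChow

theorem length_quotient_span_eq {R S : Type*} [CommRing R] [CommRing S] (e : R ≃+* S) (a : R) :
    Module.length R (R ⧸ Ideal.span {a}) = Module.length S (S ⧸ Ideal.span {e a}) := by
  have h : Ideal.span {e a} = (Ideal.span {a}).map (e : R →+* S) := by
    rw [Ideal.map_span, Set.image_singleton]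
    rfl
  let f := Ideal.quotientEquiv (Ideal.span {a}) (Ideal.span {e a}) e h
  let : Algebra R S := (e : R →+* S).toAlgebra
  rw [← Module.length_eq_of_surjective (S := R) (R := S) (M := S ⧸ Ideal.span {e a})
    e.surjective]
  refine LinearEquiv.length_eq { f with map_smul' := fun r x => ?_ }
  exact (map_mul f (Ideal.Quotient.mk _ r) x).trans rfl

/-- Lengths are invariant under ring isomorphism. Used in both directions, this makes the image of
the order map independent of the models chosen for the local ring and its fraction field. -/
theorem range_ordHom_le {R S K L : Type*} [CommRing R] [IsDomain R] [IsNoetherianRing R]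
    [Ring.DimensionLEOne R] [Field K] [Algebra R K] [IsFractionRing R K] [CommRing S] [IsDomain S]
    [IsNoetherianRing S] [Ring.DimensionLEOne S] [Field L] [Algebra S L] [IsFractionRing S L]
    (e : R ≃+* S) : (ordHom R K).range ≤ (ordHom S L).range := by
  have hint : ∀ (a : R) (x : Kˣ), (x : K) = algebraMap R K a →
      ordHom R K x ∈ (ordHom S L).range := by
    intro a x hx
    have ha : algebraMap S L (e a) ≠ 0 := by
      intro h
      have : a = 0 := by simpa using h
      exact x.ne_zero (by rw [hx, this, map_zero])
    refine ⟨Units.mk0 _ ha, Multiplicative.toAdd.injective ?_⟩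
    rw [ordHom_eq x hx, ordHom_eq (a := e a) _ (Units.val_mk0 ha), length_quotient_span_eq e]
  rintro _ ⟨x, rfl⟩
  obtain ⟨a, b, hb, hab⟩ := IsFractionRing.div_surjective (A := R) (x : K)
  have hb0 : algebraMap R K b ≠ 0 := by simpa using nonZeroDivisors.ne_zero hb
  have ha0 : algebraMap R K a ≠ 0 := by
    intro h
    exact x.ne_zero (by rw [← hab, h, zero_div])
  have hx : x = Units.mk0 _ ha0 / Units.mk0 _ hb0 := Units.ext (by simp [← hab])
  rw [hx, map_div]
  exact div_mem (hint a _ rfl) (hint b _ rfl)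

variable {R : Type*} [CommRing R] [IsDomain R] [IsNoetherianRing R] [Ring.DimensionLEOne R]

/-- There is only one maximal ideal, so the divisor group is `ℤ` and the Chow group is the cokernel
of `ord m`. -/
theorem subsingleton_chow_iff_ord_surjective [IsLocalRing R] (m : MaximalSpectrum R) :
    Subsingleton (Chow R) ↔ Function.Surjective (ord m) := by
  have huniq : ∀ q : MaximalSpectrum R, q = m := fun q => MaximalSpectrum.ext
    ((IsLocalRing.eq_maximalIdeal q.isMaximal).trans (IsLocalRing.eq_maximalIdeal m.isMaximal).symm)
  rw [QuotientAddGroup.subsingleton_iff, principalDivisors, AddMonoidHom.range_eq_top]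
  constructor
  · intro h n
    obtain ⟨x, hx⟩ := h (Finsupp.single m n.toAdd)
    refine ⟨x.toMul, Multiplicative.toAdd.injective ?_⟩
    rw [← divisor_apply, ofMul_toMul, hx, Finsupp.single_eq_same]
  · intro h D
    obtain ⟨x, hx⟩ := h (Multiplicative.ofAdd (D m))
    refine ⟨Additive.ofMul x, Finsupp.ext fun q => ?_⟩
    rw [huniq q, divisor_apply, hx, toAdd_ofAdd]

theorem subsingleton_chow_localization_iff (p : MaximalSpectrum R) :
    Subsingleton (Chow (Localization.AtPrime p.asIdeal)) ↔ Function.Surjective (ord p) := by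
  let m : MaximalSpectrum (Localization.AtPrime p.asIdeal) :=
    ⟨IsLocalRing.maximalIdeal _, inferInstance⟩
  -- Localizing a local ring at its maximal ideal inverts only units, so it changes nothing.
  let e : Localization.AtPrime p.asIdeal ≃+* Localization.AtPrime m.asIdeal :=
    (IsLocalization.atUnits (Localization.AtPrime p.asIdeal) m.asIdeal.primeCompl
      (S := Localization.AtPrime m.asIdeal) fun x hx => by
        exact (by simpa [m] using hx : IsUnit x)).toRingEquiv
  have := dimensionLEOne_localization m
  rw [subsingleton_chow_iff_ord_surjective m, ← MonoidHom.range_eq_top, ← MonoidHom.range_eq_top,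
    ord, ord, le_antisymm
      (range_ordHom_le (K := FractionRing (Localization.AtPrime p.asIdeal))
        (L := FractionRing R) e.symm) (range_ordHom_le e)]

variable (R)

theorem picToChow_surjective_iff : Function.Surjective (picToChow R) ↔
    ∀ p : MaximalSpectrum R, Subsingleton (Chow (Localization.AtPrime p.asIdeal)) := by
  simp only [subsingleton_chow_localization_iff]
  constructor
  · intro h p
    -- The image is a subgroup of `ℤ`, so reaching the generator is enough.
    suffices h1 : Multiplicative.ofAdd (1 : ℤ) ∈ (ord p).range by
      intro n
      obtain ⟨x, hx⟩ := h1
      refine ⟨x ^ n.toAdd, ?_⟩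
      rw [map_zpow, hx, ← ofAdd_zsmul]
      simp
    obtain ⟨c, hc⟩ := h (QuotientAddGroup.mk (Finsupp.single p 1))
    obtain ⟨c, rfl⟩ := Additive.ofMul.surjective c
    obtain ⟨I, rfl⟩ := mk_surjective c
    rw [picToChow_mk, QuotientAddGroup.eq] at hc
    obtain ⟨x, hx⟩ := hc
    -- Here `div x = p - div I`. If `y` generates `I` at `p`, the coefficients at `p` give `ord_p(y
    -- x) = 1`.
    obtain ⟨y, hy⟩ := exists_localize_eq p I
    have hIy : ordIdeal p I = ord p y := by
      rw [← ordIdeal_toPrincipalIdeal, ordIdeal, MonoidHom.comp_apply, MonoidHom.comp_apply, hy]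
    have h1 := DFunLike.congr_fun hx p
    rw [Finsupp.add_apply, Finsupp.neg_apply, divisorIdeal_apply, Finsupp.single_eq_same,
      ← ofMul_toMul x, divisor_apply, hIy, eq_neg_add_iff_add_eq] at h1
    refine ⟨y * x.toMul, Multiplicative.toAdd.injective ?_⟩
    rw [map_mul, toAdd_mul, h1, toAdd_ofAdd]
  · intro h
    rw [← AddMonoidHom.range_eq_top, eq_top_iff]
    rintro c -
    obtain ⟨D, rfl⟩ := QuotientAddGroup.mk_surjective c
    induction D using Finsupp.induction_linear with
    | zero => exact zero_mem _
    | add D E hD hE => exact add_mem hD hE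
    | single p n =>
      obtain ⟨x, hx⟩ := h p (Multiplicative.ofAdd n)
      obtain ⟨I, hI⟩ := exists_divisorIdeal_eq_single p x
      refine ⟨Additive.ofMul (ClassGroup.mk _ I), ?_⟩
      rw [picToChow_mk, hI, hx, toAdd_ofAdd]

end LocalChow

/-! ### Locally trivial fractional ideals -/

section LocallyTrivial

variable {R : Type*} [CommRing R] [IsDomain R] [IsNoetherianRing R]

/-- Each element of `I` lies in `R_p`, and `I` is finitely generated, so one denominator outside `p`
serves for all of `I`. -/
theorem exists_mul_mem_of_localize_eq_one {p : MaximalSpectrum R}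
    {I : (FractionalIdeal R⁰ (FractionRing R))ˣ} (h : localize p I = 1) :
    ∃ s ∉ p.asIdeal, ∀ x ∈ (I : FractionalIdeal R⁰ (FractionRing R)), ∃ y : R,
      algebraMap R _ y = algebraMap R _ s * x := by
  obtain ⟨s, hs, h⟩ := exists_notMem_forall_smul_mem (p := p.asIdeal)
    (N := ((I : FractionalIdeal R⁰ (FractionRing R)) : Submodule R (FractionRing R)))
    (P := (1 : Submodule R (FractionRing R)))
    (FractionalIdeal.fg_of_isNoetherianRing le_rfl _) fun x hx => by
      have hx1 : x ∈ (1 : FractionalIdeal (Localization.AtPrime p.asIdeal)⁰ (FractionRing R)) := by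
        rw [← Units.val_one, ← h]
        refine (FractionalIdeal.mem_extended_iff _ _ _ x).mpr (Submodule.subset_span ⟨x, hx, ?_⟩)
        exact fractionRing_map_eq p x
      obtain ⟨z, rfl⟩ := (FractionalIdeal.mem_one_iff _).mp hx1
      obtain ⟨r, s, rfl⟩ := IsLocalization.exists_mk'_eq p.asIdeal.primeCompl z
      refine ⟨s, s.2, Submodule.mem_one.mpr ⟨r, ?_⟩⟩
      rw [Algebra.smul_def, IsScalarTower.algebraMap_apply R (Localization.AtPrime p.asIdeal),
        IsScalarTower.algebraMap_apply R (Localization.AtPrime p.asIdeal) _ (s : R), ← map_mul,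
        IsLocalization.mk'_spec']
  refine ⟨s, hs, fun x hx => ?_⟩
  obtain ⟨y, hy⟩ := Submodule.mem_one.mp (h x hx)
  exact ⟨y, by rw [hy, Algebra.smul_def]⟩

/-- A denominator `a` for the inverse satisfies `a I⁻¹ ≤ 1`; multiplying by `I` gives `a ∈ I`. -/
theorem exists_mem_of_localize_eq_one {p : MaximalSpectrum R}
    {I : (FractionalIdeal R⁰ (FractionRing R))ˣ} (h : localize p I = 1) :
    ∃ a ∉ p.asIdeal,
      algebraMap R (FractionRing R) a ∈ (I : FractionalIdeal R⁰ (FractionRing R)) := by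
  obtain ⟨a, ha, haI⟩ := exists_mul_mem_of_localize_eq_one (I := I⁻¹)
    (by rw [map_inv, h, inv_one])
  refine ⟨a, ha, ?_⟩
  have hle : FractionalIdeal.spanSingleton R⁰ (algebraMap R (FractionRing R) a) *
      ((I⁻¹ : (FractionalIdeal R⁰ (FractionRing R))ˣ) : FractionalIdeal R⁰ (FractionRing R)) ≤ 1 :=
    FractionalIdeal.spanSingleton_mul_le_iff.mpr fun x hx => by
      obtain ⟨y, hy⟩ := haI x hx
      rw [← hy]
      exact FractionalIdeal.coe_mem_one _ y
  have hle' := mul_le_mul_left hle (I : FractionalIdeal R⁰ (FractionRing R))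
  rw [mul_assoc, Units.inv_mul, mul_one, one_mul] at hle'
  exact hle' (FractionalIdeal.mem_spanSingleton_self _ _)

theorem le_one_of_forall_localize_eq_one {I : (FractionalIdeal R⁰ (FractionRing R))ˣ}
    (h : ∀ p, localize p I = 1) : (I : FractionalIdeal R⁰ (FractionRing R)) ≤ 1 := by
  intro x hx
  -- `J` is the ideal of denominators of `x`. It lies in no maximal ideal, so it contains `1`.
  let J : Ideal R := (1 : Submodule R (FractionRing R)).comap (LinearMap.toSpanSingleton R _ x)
  have hJ : J = ⊤ := by
    by_contra hcon
    obtain ⟨m, hm, hle⟩ := Ideal.exists_le_maximal _ hcon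
    obtain ⟨s, hs, hsI⟩ := exists_mul_mem_of_localize_eq_one (h ⟨m, hm⟩)
    obtain ⟨y, hy⟩ := hsI x hx
    exact hs (hle (Submodule.mem_one.mpr ⟨y, by
      rw [hy, LinearMap.toSpanSingleton_apply, Algebra.smul_def]⟩))
  have h1 : (1 : R) ∈ J := hJ ▸ Submodule.mem_top
  obtain ⟨y, hy⟩ := Submodule.mem_one.mp (Submodule.mem_comap.mp h1)
  exact (FractionalIdeal.mem_one_iff _).mpr ⟨y, by simpa using hy⟩

theorem eq_one_of_forall_localize_eq_one {I : (FractionalIdeal R⁰ (FractionRing R))ˣ}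
    (h : ∀ p, localize p I = 1) : I = 1 := by
  refine Units.ext (le_antisymm (le_one_of_forall_localize_eq_one h) ?_)
  have hle := le_one_of_forall_localize_eq_one (I := I⁻¹) fun p => by rw [map_inv, h p, inv_one]
  have hle' := mul_le_mul_left hle (I : FractionalIdeal R⁰ (FractionRing R))
  rwa [Units.inv_mul, one_mul] at hle'

end LocallyTrivial

/-! ### The Dedekind case: `picToChow` is an isomorphism -/

section Dedekind

theorem ordHom_surjective_of_isDiscreteValuationRing {R K : Type*} [CommRing R] [IsDomain R]
    [IsNoetherianRing R] [Ring.DimensionLEOne R] [IsDiscreteValuationRing R] [Field K] [Algebra R K]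
    [IsFractionRing R K] : Function.Surjective (ordHom R K) := by
  obtain ⟨ϖ, hϖ⟩ := IsDiscreteValuationRing.exists_irreducible R
  have hϖ0 : algebraMap R K ϖ ≠ 0 := by simpa using hϖ.ne_zero
  intro n
  refine ⟨Units.mk0 _ hϖ0 ^ n.toAdd, Multiplicative.toAdd.injective ?_⟩
  have h : Module.length R (R ⧸ Ideal.span {ϖ}) = 1 := Ring.ord_of_irreducible hϖ
  rw [map_zpow, toAdd_zpow, ordHom_eq _ (Units.val_mk0 hϖ0), h]
  simp

theorem toPrincipalIdeal_eq_one_of_ordHom_eq_one {R K : Type*} [CommRing R] [IsDomain R]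
    [IsNoetherianRing R] [Ring.DimensionLEOne R] [IsDiscreteValuationRing R] [Field K] [Algebra R K]
    [IsFractionRing R K] {x : Kˣ} (hx : ordHom R K x = 1) : toPrincipalIdeal R K x = 1 := by
  have h1 : Ring.ordFrac R (x : K) = 1 := by
    have h : ((ordHom R K x : Multiplicative ℤ) : WithZero (Multiplicative ℤ)) =
        Ring.ordFrac R (x : K) := WithZero.coe_unitsWithZeroEquiv_eq_units_val _
    rw [← h, hx, WithZero.coe_one]
  obtain ⟨u, hu⟩ := Ring.associated_of_ordFrac_eq (R := R) (1 : K) (x : K) (by rw [h1, map_one])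
  rw [toPrincipalIdeal_eq_iff, ← hu, Units.smul_def, Algebra.smul_def, mul_one,
    ← FractionalIdeal.coeIdeal_span_singleton, Ideal.span_singleton_eq_top.mpr u.isUnit]
  simp

variable {R : Type*} [CommRing R] [IsDedekindDomain R]

/-- The localizations are discrete valuation rings, where order zero means trivial ideal and a
uniformizer has order one. Injectivity then follows because locally trivial ideals are trivial,
surjectivity from the local criterion. A field has to be excluded: its only maximal ideal is zero,
all orders vanish, and its Chow group is `ℤ`. -/
theorem picToChow_bijective (hR : ¬ IsField R) : Function.Bijective (picToChow R) := by
  have hdvr : ∀ p : MaximalSpectrum R,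
      IsDiscreteValuationRing (Localization.AtPrime p.asIdeal) := fun p =>
    IsLocalization.AtPrime.isDiscreteValuationRing_of_dedekind_domain R
      (Ring.ne_bot_of_isMaximal_of_not_isField p.isMaximal hR) _
  constructor
  · rw [injective_iff_map_eq_zero]
    intro c hc
    obtain ⟨c, rfl⟩ := Additive.ofMul.surjective c
    obtain ⟨I, rfl⟩ := mk_surjective c
    rw [picToChow_mk] at hc
    obtain ⟨x, hx⟩ := (QuotientAddGroup.eq_zero_iff _).mp hc
    have hI : I / toPrincipalIdeal R _ x.toMul = 1 := by
      refine eq_one_of_forall_localize_eq_one fun p => ?_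
      have hp : ordIdeal p (I / toPrincipalIdeal R _ x.toMul) = 1 := by
        rw [map_div, ordIdeal_toPrincipalIdeal, div_eq_one]
        exact Multiplicative.toAdd.injective (DFunLike.congr_fun hx p).symm
      obtain ⟨y, hy⟩ := toPrincipalIdeal_surjective
        (localize p (I / toPrincipalIdeal R _ x.toMul))
      have := hdvr p
      rw [ordIdeal, MonoidHom.comp_apply, ← hy, ordIdealHom_toPrincipalIdeal] at hp
      rw [← hy, toPrincipalIdeal_eq_one_of_ordHom_eq_one hp]
    rw [div_eq_one] at hI
    rw [ofMul_eq_zero, hI, ← ClassGroup.Quot_mk_eq_mk]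
    exact (QuotientGroup.eq_one_iff _).mpr ⟨_, rfl⟩
  · rw [picToChow_surjective_iff]
    intro p
    have := hdvr p
    exact (subsingleton_chow_localization_iff p).mpr ordHom_surjective_of_isDiscreteValuationRing

end Dedekind

/-! ### Locality of push-forward -/

section PushforwardCongr

variable {A B : Type*} [CommRing A] [CommRing B] [Algebra A B] [Algebra.IsIntegral A B]

/-- Only primes over `p` contribute to the coefficient at `p`. This permits replacing an ideal by a
local generator, one `p` at a time. -/
theorem pushforward_apply_congr {D E : Divisor B} {p : MaximalSpectrum A}
    (h : ∀ P, under A P = p → D P = E P) : pushforward A B D p = pushforward A B E p := by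
  classical
  rw [← sub_eq_zero, ← Finsupp.sub_apply, ← map_sub, pushforward_apply]
  refine Finset.sum_eq_zero fun P hP => ?_
  rw [Finsupp.sub_apply, h P (Finset.mem_filter.mp hP).2, sub_self, mul_zero]

end PushforwardCongr

/-! ### Push-forward of the divisor of an extended ideal -/

section Extension

variable (A B : Type*) [CommRing A] [CommRing B] [IsDomain A] [IsDomain B] [Algebra A B]
  [Module.IsTorsionFree A B]

/-- The extension `𝔞 ↦ 𝔞 B` of invertible fractional ideals. -/
def extendUnits : (FractionalIdeal A⁰ (FractionRing A))ˣ →*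
    (FractionalIdeal B⁰ (FractionRing B))ˣ :=
  Units.map (FractionalIdeal.extendedHom (FractionRing B) B).toMonoidHom

/-- The map `Frac(A)* → Frac(B)*`. -/
def mapUnits : (FractionRing A)ˣ →* (FractionRing B)ˣ :=
  Units.map (IsFractionRing.map (K := FractionRing A) (L := FractionRing B)
    (FaithfulSMul.algebraMap_injective A B)).toMonoidHom

variable {A B}

theorem extendUnits_toPrincipalIdeal (x : (FractionRing A)ˣ) :
    extendUnits A B (toPrincipalIdeal A _ x) = toPrincipalIdeal B _ (mapUnits A B x) := by
  ext1
  simp only [extendUnits, mapUnits, Units.coe_map, coe_toPrincipalIdeal]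
  exact FractionalIdeal.extendedHom_spanSingleton _ _ _

theorem mapUnits_eq {a : A} {x : (FractionRing A)ˣ} (hx : (x : FractionRing A) = algebraMap A _ a) :
    (mapUnits A B x : FractionRing B) = algebraMap B _ (algebraMap A B a) := by
  rw [mapUnits, Units.coe_map, hx]
  exact IsLocalization.map_eq _ _

variable [IsNoetherianRing A] [IsNoetherianRing B] [Ring.DimensionLEOne B] [Algebra.IsIntegral A B]

/-- The elements `s` and `a` of `A` that witness triviality of `I` at `P ∩ A` lie outside `P`, and
they witness triviality of `I B` at `P`. -/
theorem ordIdeal_extendUnits_eq_one {P : MaximalSpectrum B}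
    {I : (FractionalIdeal A⁰ (FractionRing A))ˣ} (h : localize (under A P) I = 1) :
    ordIdeal P (extendUnits A B I) = 1 := by
  obtain ⟨s, hs, hsI⟩ := exists_mul_mem_of_localize_eq_one h
  obtain ⟨a, ha, haI⟩ := exists_mem_of_localize_eq_one h
  refine ordIdeal_eq_one (s := algebraMap A B s) (a := algebraMap A B a) (fun x hx => ?_) ?_ hs ha
  · replace hx := (FractionalIdeal.mem_extended_iff _ _ _ x).mp hx
    induction hx using Submodule.span_induction with
    | mem x hx =>
      obtain ⟨z, hz, rfl⟩ := hx
      obtain ⟨y, hy⟩ := hsI z hz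
      refine ⟨algebraMap A B y, ?_⟩
      have h1 := congrArg (IsLocalization.map (FractionRing B) (algebraMap A B)
        (nonZeroDivisors_le_comap_nonZeroDivisors_of_injective _
          (FaithfulSMul.algebraMap_injective A B))) hy
      rwa [map_mul, IsLocalization.map_eq, IsLocalization.map_eq] at h1
    | zero => exact ⟨0, by simp⟩
    | add x y _ _ hx hy =>
      obtain ⟨b, hb⟩ := hx
      obtain ⟨c, hc⟩ := hy
      exact ⟨b + c, by rw [map_add, hb, hc, mul_add]⟩
    | smul r x _ hx =>
      obtain ⟨b, hb⟩ := hx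
      exact ⟨r * b, by rw [map_mul, hb, Algebra.smul_def]; ring⟩
  · exact (FractionalIdeal.mem_extended_iff _ _ _ _).mpr (Submodule.subset_span
      ⟨_, haI, IsLocalization.map_eq _ _⟩)

variable [Ring.DimensionLEOne A] [Module.Finite A B]

theorem pushforward_divisor_mapUnits {d : A} (hd0 : d ≠ 0)
    (hd : ∀ b : B, ∃ c : A, algebraMap A B c = algebraMap A B d * b) (x : (FractionRing A)ˣ) :
    pushforward A B (divisor B (Additive.ofMul (mapUnits A B x))) =
      divisor A (Additive.ofMul x) := by
  have hinj := FaithfulSMul.algebraMap_injective A B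
  obtain ⟨a, b, ha, hb, y, z, hy, hz, rfl⟩ := exists_units_eq_div x
  rw [map_div, ofMul_div, ofMul_div, map_sub, map_sub, map_sub,
    pushforward_divisor_algebraMap hinj hd0 hd y _ hy (mapUnits_eq hy),
    pushforward_divisor_algebraMap hinj hd0 hd z _ hz (mapUnits_eq hz)]

/-- Let `x` generate `I` at `p`. Then `I / x` is trivial at `p`, so its extension has order zero at
every `P` over `p`. The coefficient at `p` is therefore that of a principal divisor, where the
formula is known. -/
theorem pushforward_divisorIdeal_extendUnits {d : A} (hd0 : d ≠ 0)
    (hd : ∀ b : B, ∃ c : A, algebraMap A B c = algebraMap A B d * b)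
    (I : (FractionalIdeal A⁰ (FractionRing A))ˣ) :
    pushforward A B (divisorIdeal B (Additive.ofMul (extendUnits A B I))) =
      divisorIdeal A (Additive.ofMul I) := by
  ext p
  obtain ⟨x, hx⟩ := exists_localize_eq p I
  have hp : divisorIdeal A (Additive.ofMul I) p = divisor A (Additive.ofMul x) p := by
    rw [divisorIdeal_apply, divisor_apply, ← ordIdeal_toPrincipalIdeal, ordIdeal,
      MonoidHom.comp_apply, MonoidHom.comp_apply, hx]
  rw [hp, ← pushforward_divisor_mapUnits hd0 hd x]
  refine pushforward_apply_congr fun P hP => ?_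
  subst hP
  rw [divisorIdeal_apply, divisor_apply, ← ordIdeal_toPrincipalIdeal,
    ← extendUnits_toPrincipalIdeal]
  refine congrArg _ (div_eq_one.mp ?_)
  rw [← map_div, ← map_div]
  exact ordIdeal_extendUnits_eq_one (by rw [map_div, hx, div_self'])

end Extension

/-! ### Surjectivity of extension on ideal classes -/

section ExtensionSurjective

variable {A B : Type*} [CommRing A] [CommRing B] [Algebra A B]

theorem map_comap_eq_of_sup_span_eq_top {d : A}
    (hd : ∀ b : B, ∃ c : A, algebraMap A B c = algebraMap A B d * b) {I : Ideal B}
    (hI : I ⊔ Ideal.span {algebraMap A B d} = ⊤) :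
    (I.comap (algebraMap A B)).map (algebraMap A B) = I := by
  refine le_antisymm Ideal.map_comap_le fun x hx => ?_
  obtain ⟨i, hi, z, hz, hiz⟩ := Submodule.mem_sup.mp (hI ▸ Submodule.mem_top : (1 : B) ∈ _)
  obtain ⟨b, rfl⟩ := Ideal.mem_span_singleton.mp hz
  obtain ⟨c, hc⟩ := hd b
  obtain ⟨e, he⟩ := hd x
  have h1 : 1 - c ∈ I.comap (algebraMap A B) := by
    rw [Ideal.mem_comap, map_sub, map_one, hc, ← hiz, add_sub_cancel_right]
    exact hi
  have h2 : e ∈ I.comap (algebraMap A B) := by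
    rw [Ideal.mem_comap, he]
    exact I.mul_mem_left _ hx
  -- With `1 = i + d b`, `c = d b` and `e = d x`, both `1 - c` and `e` belong to the contraction of
  -- `I`.
  have hx' : x = x * algebraMap A B (1 - c) + b * algebraMap A B e := by
    rw [map_sub, map_one, hc, he]
    ring
  rw [hx']
  exact Ideal.add_mem _ (Ideal.mul_mem_left _ _ (Ideal.mem_map_of_mem _ h1))
    (Ideal.mul_mem_left _ _ (Ideal.mem_map_of_mem _ h2))

variable [IsDedekindDomain B]

/-- This makes the contraction `J` of `I` invertible. In `B` one has `I I' = (a)`. Multiplying `I'`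
by `d` brings it into `A`, but then the product with `J` only reaches `a d B`; adding `(a)` to the
cofactor recovers `a`, because `J` contains some `1 - c` with `c ∈ d B`. -/
theorem exists_comap_mul_eq_span (hinj : Function.Injective (algebraMap A B)) {d : A} (hd0 : d ≠ 0)
    (hd : ∀ b : B, ∃ c : A, algebraMap A B c = algebraMap A B d * b) {I : Ideal B}
    (hI0 : I ≠ ⊥) (hI : I ⊔ Ideal.span {algebraMap A B d} = ⊤) :
    ∃ a : A, a ≠ 0 ∧ ∃ L : Ideal A, I.comap (algebraMap A B) * L = Ideal.span {a} := by
  obtain ⟨i₀, hi₀, hi₀0⟩ := Submodule.exists_mem_ne_zero_of_ne_bot hI0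
  obtain ⟨a, ha⟩ := hd i₀
  have hd0' : algebraMap A B d ≠ 0 := by simpa using hinj.ne hd0
  have ha0 : a ≠ 0 := by
    rintro rfl
    rw [map_zero] at ha
    exact mul_ne_zero hd0' hi₀0 ha.symm
  obtain ⟨I', hI'⟩ : I ∣ Ideal.span {algebraMap A B a} := by
    rw [Ideal.dvd_span_singleton, ha]
    exact I.mul_mem_left _ hi₀
  set J := I.comap (algebraMap A B) with hJ
  let L := (Ideal.span {algebraMap A B d} * I').comap (algebraMap A B)
  refine ⟨a, ha0, L ⊔ Ideal.span {a}, le_antisymm ?_ ?_⟩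
  · rw [Ideal.mul_sup, sup_le_iff]
    refine ⟨Ideal.mul_le.mpr fun j hj y hy => ?_, Ideal.mul_le_right⟩
    obtain ⟨z, hz, hzy⟩ := Ideal.mem_span_singleton_mul.mp hy
    have h1 : algebraMap A B j * z ∈ Ideal.span {algebraMap A B a} := by
      rw [hI']
      exact Ideal.mul_mem_mul hj hz
    obtain ⟨β, hβ⟩ := Ideal.mem_span_singleton.mp h1
    -- From `j z = a β` one gets `j (d z) = a (d β)`, and `d β` comes from `A`.
    obtain ⟨e, he⟩ := hd β
    refine Ideal.mem_span_singleton.mpr ⟨e, hinj ?_⟩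
    rw [map_mul, map_mul, ← hzy, mul_left_comm, hβ, he, mul_left_comm]
  · have key : ∀ x ∈ I * I', ∀ y : A, algebraMap A B y = algebraMap A B d * x → y ∈ J * L := by
      intro x hx
      -- Since `I = J B`, every element of `I I'` is a sum of products `j i` with `j ∈ J`, `i ∈ I'`;
      -- then `d (j i) = j (d i)` with `d i` in `L`.
      have hx' : x ∈ J • I'.restrictScalars A := by
        rw [← Ideal.smul_restrictScalars, map_comap_eq_of_sup_span_eq_top hd hI]
        exact hx
      refine Submodule.smul_induction_on hx' (fun j hj i hi y hy => ?_) fun x y hx hy z hz => ?_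
      · obtain ⟨e, he⟩ := hd i
        have hye : y = j * e := hinj (by
          rw [hy, map_mul, he, Algebra.smul_def, mul_left_comm])
        rw [hye]
        exact Ideal.mul_mem_mul hj (Ideal.mem_span_singleton_mul.mpr ⟨i, hi, he.symm⟩)
      · obtain ⟨e, he⟩ := hd x
        obtain ⟨f, hf⟩ := hd y
        have hzef : z = e + f := hinj (by rw [hz, map_add, he, hf, mul_add])
        rw [hzef]
        exact add_mem (hx e he) (hy f hf)
    obtain ⟨i, hi, z, hz, hiz⟩ := Submodule.mem_sup.mp (hI ▸ Submodule.mem_top : (1 : B) ∈ _)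
    obtain ⟨b, rfl⟩ := Ideal.mem_span_singleton.mp hz
    obtain ⟨c, hc⟩ := hd b
    have h1 : 1 - c ∈ J := by
      rw [hJ, Ideal.mem_comap, map_sub, map_one, hc, ← hiz, add_sub_cancel_right]
      exact hi
    have h2 : a * c ∈ J * L := by
      refine key (algebraMap A B a * b) ?_ _ (by rw [map_mul, hc, mul_left_comm])
      rw [← hI']
      exact Ideal.mul_mem_right _ _ (Ideal.mem_span_singleton_self _)
    rw [Ideal.span_singleton_le_iff_mem, Ideal.mul_sup]
    have h3 : a = a * c + (1 - c) * a := by ring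
    have h4 := Ideal.mul_mem_mul h1 (Ideal.mem_span_singleton_self a)
    have h5 := add_mem (Ideal.mem_sup_left h2) (Ideal.mem_sup_right h4)
    rwa [← h3] at h5

/-- Every ideal class of a Dedekind domain has a representative prime to a given element. -/
theorem exists_mk0_eq_and_sup_span_eq_top {R : Type*} [CommRing R] [IsDedekindDomain R] {d : R}
    (hd : d ≠ 0) (c : ClassGroup R) :
    ∃ I : nonZeroDivisors (Ideal R), ClassGroup.mk0 I = c ∧
      (I : Ideal R) ⊔ Ideal.span {d} = ⊤ := by
  obtain ⟨M, hM⟩ := ClassGroup.mk0_surjective c⁻¹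
  have hM0 : (M : Ideal R) ≠ 0 := nonZeroDivisors.ne_zero M.2
  have hd0 : Ideal.span {d} * (M : Ideal R) ≠ 0 := mul_ne_zero (by simpa using hd) hM0
  -- Writing `M = d M + (a)` and `(a) = M N`, cancellation of `M` gives `(d) + N = (1)`, while `N`
  -- has class inverse to that of `M`, namely `c`.
  obtain ⟨a, ha0, ha⟩ : ∃ a ≠ 0, Ideal.span {d} * (M : Ideal R) ⊔ Ideal.span {a} = M := by
    obtain ⟨a, ha⟩ := IsDedekindDomain.exists_sup_span_eq
      (Ideal.mul_le_right : Ideal.span {d} * (M : Ideal R) ≤ M) hd0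
    -- If `a = 0`, then `d M = M` and any nonzero element of `M` can replace it.
    by_cases ha0 : a = 0
    · obtain ⟨m, hm, hm0⟩ := Submodule.exists_mem_ne_zero_of_ne_bot hM0
      rw [ha0, Ideal.span_singleton_zero, sup_bot_eq] at ha
      exact ⟨m, hm0, by rw [ha]; exact sup_eq_left.mpr ((Ideal.span_singleton_le_iff_mem _).mpr hm)⟩
    · exact ⟨a, ha0, ha⟩
  obtain ⟨N, hN⟩ : (M : Ideal R) ∣ Ideal.span {a} :=
    Ideal.dvd_iff_le.mpr (le_sup_right.trans ha.le)
  have hN0 : N ≠ 0 := by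
    rintro rfl
    rw [mul_zero] at hN
    exact ha0 (Ideal.span_singleton_eq_bot.mp hN)
  refine ⟨⟨N, mem_nonZeroDivisors_of_ne_zero hN0⟩, ?_, ?_⟩
  · rw [← inv_inv c, ← hM, eq_inv_iff_mul_eq_one, ← map_mul, mul_comm]
    refine (ClassGroup.mk0_eq_one_iff (I := (M : Ideal R) * N)
      (mem_nonZeroDivisors_of_ne_zero (mul_ne_zero hM0 hN0))).mpr ?_
    rw [← hN]
    exact ⟨a, rfl⟩
  · rw [hN, mul_comm, ← Ideal.mul_sup] at ha
    rw [sup_comm]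
    refine mul_left_cancel₀ hM0 ?_
    rw [ha, Ideal.mul_top]

theorem extendedHom_surjective [IsDomain A] [Module.IsTorsionFree A B] {d : A} (hd0 : d ≠ 0)
    (hd : ∀ b : B, ∃ c : A, algebraMap A B c = algebraMap A B d * b) :
    Function.Surjective (ClassGroup.extendedHom A B) := by
  have hinj := FaithfulSMul.algebraMap_injective A B
  intro c
  obtain ⟨I, rfl, hI⟩ := exists_mk0_eq_and_sup_span_eq_top (d := algebraMap A B d)
    (by simpa using hinj.ne hd0) c
  obtain ⟨a, ha0, L, hL⟩ := exists_comap_mul_eq_span hinj hd0 hd (nonZeroDivisors.ne_zero I.2) hI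
  have hu : IsUnit ((((I : Ideal B).comap (algebraMap A B) : Ideal A) :
      FractionalIdeal A⁰ (FractionRing A)) * (L : FractionalIdeal A⁰ (FractionRing A))) := by
    rw [← FractionalIdeal.coeIdeal_mul, hL, FractionalIdeal.coeIdeal_span_singleton]
    have ha : algebraMap A (FractionRing A) a ≠ 0 := by simpa using ha0
    rw [← Units.val_mk0 ha, ← coe_toPrincipalIdeal]
    exact Units.isUnit _
  obtain ⟨u, hu'⟩ := isUnit_of_mul_isUnit_left hu
  refine ⟨ClassGroup.mk _ u, ?_⟩
  rw [ClassGroup.extendedHom_mk, ← ClassGroup.mk_mk0 (FractionRing B)]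
  congr 1
  ext1
  refine (congrArg (FractionalIdeal.extendedHom (FractionRing B) B) hu').trans ?_
  rw [FractionalIdeal.extendedHom_coeIdeal_eq_map, map_comap_eq_of_sup_span_eq_top hd hI]
  rfl

end ExtensionSurjective

/-! ### The normalization and the injectivity criterion -/

section Normalization

variable (O : Type*) [CommRing O] [IsDomain O]

instance isIntegrallyClosed_normalization : IsIntegrallyClosed (Normalization O) :=
  integralClosure.isIntegrallyClosedOfFiniteExtension (FractionRing O)

theorem not_isField_normalization (hO : ¬ IsField O) : ¬ IsField (Normalization O) := fun h =>
  hO (isField_of_isIntegral_of_isField (FaithfulSMul.algebraMap_injective O (Normalization O)) h)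

variable [IsNoetherianRing O] [Ring.DimensionLEOne O] [Module.Finite O (Normalization O)]

instance isDedekindDomain_normalization : IsDedekindDomain (Normalization O) where

theorem pushforwardChow_mk (D : Divisor (Normalization O)) :
    pushforwardChow O (D : Chow (Normalization O)) =
      (pushforward O (Normalization O) D : Chow O) := rfl

/-- On ideals this is the formula for the push-forward of an extended divisor, passed to classes. -/
theorem picToChow_eq_pushforwardChow (c : ClassGroup O) :
    picToChow O (Additive.ofMul c) = pushforwardChow O (picToChow (Normalization O)
      (Additive.ofMul (ClassGroup.extendedHom O (Normalization O) c))) := by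
  obtain ⟨d, hd0, hd⟩ := exists_conductor O
  obtain ⟨I, rfl⟩ := mk_surjective c
  rw [ClassGroup.extendedHom_mk, picToChow_mk, picToChow_mk, pushforwardChow_mk,
    ← pushforward_divisorIdeal_extendUnits hd0 hd I]
  rfl

theorem ker_pushforwardChow : (pushforwardChow O).ker =
    (pushforward O (Normalization O)).ker.map
      (QuotientAddGroup.mk' (principalDivisors (Normalization O))) := by
  obtain ⟨d, hd0, hd⟩ := exists_conductor O
  ext c
  obtain ⟨D, rfl⟩ := QuotientAddGroup.mk_surjective c
  rw [AddMonoidHom.mem_ker, pushforwardChow_mk, QuotientAddGroup.eq_zero_iff]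
  constructor
  · rintro ⟨x, hx⟩
    -- If `f_* D = div_O(x)`, subtracting `div_Õ(x)` keeps the class of `D` and makes the
    -- push-forward vanish.
    refine ⟨D - divisor _ (Additive.ofMul (mapUnits O (Normalization O) x.toMul)), ?_, ?_⟩
    · rw [SetLike.mem_coe, AddMonoidHom.mem_ker, map_sub, pushforward_divisor_mapUnits hd0 hd, ← hx]
      exact sub_self _
    · rw [map_sub]
      refine sub_eq_self.mpr ?_
      exact (QuotientAddGroup.eq_zero_iff _).mpr ⟨_, rfl⟩
  · rintro ⟨E, hE, hED⟩
    have h : pushforwardChow O (E : Chow (Normalization O)) = pushforwardChow O D :=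
      congrArg _ hED
    rw [pushforwardChow_mk, pushforwardChow_mk, AddMonoidHom.mem_ker.mp hE] at h
    exact (QuotientAddGroup.eq_zero_iff _).mp h.symm

/-- In the factorization through the normalization, extension is surjective and the middle map
bijective. Every class in `Chow(Õ)` thus comes from `Pic(O)`, so injectivity of the composite forces
that of the push-forward as well. -/
theorem picToChow_injective_iff (hO : ¬ IsField O) : Function.Injective (picToChow O) ↔
    Function.Bijective (ClassGroup.extendedHom O (Normalization O)) ∧
      (pushforwardChow O).ker = ⊥ := by
  obtain ⟨d, hd0, hd⟩ := exists_conductor O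
  have hsurj : Function.Surjective (ClassGroup.extendedHom O (Normalization O)) :=
    extendedHom_surjective hd0 hd
  have hbij := picToChow_bijective (not_isField_normalization O hO)
  rw [AddMonoidHom.ker_eq_bot_iff]
  constructor
  · intro h
    refine ⟨⟨fun c c' hcc => ?_, hsurj⟩, ?_⟩
    · refine Additive.ofMul.injective (h ?_)
      rw [picToChow_eq_pushforwardChow O c, picToChow_eq_pushforwardChow O c', hcc]
    · rw [injective_iff_map_eq_zero]
      intro D hD
      obtain ⟨c, rfl⟩ := hbij.2 D
      obtain ⟨c, rfl⟩ := Additive.ofMul.surjective c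
      obtain ⟨c, rfl⟩ := hsurj c
      rw [← picToChow_eq_pushforwardChow O c, map_eq_zero_iff _ h, ofMul_eq_zero] at hD
      rw [hD, map_one, ofMul_one, map_zero]
  · rintro ⟨hg, hF⟩
    have : (picToChow O : Additive (ClassGroup O) → Chow O) = pushforwardChow O ∘
        picToChow (Normalization O) ∘ Additive.ofMul ∘
        ClassGroup.extendedHom O (Normalization O) ∘ Additive.toMul :=
      funext fun c => picToChow_eq_pushforwardChow O c.toMul
    rw [this]
    exact hF.comp (hbij.1.comp (Additive.ofMul.injective.comp
      (hg.1.comp Additive.toMul.injective)))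

end Normalization

end ChowGroup

end

theorem proposition2p13 (O : Type*) [CommRing O] [IsDomain O] [IsNoetherianRing O]
    [Ring.DimensionLEOne O] (hO : ¬ IsField O) [Module.Finite O (ChowGroup.Normalization O)] :
    (Function.Surjective (ChowGroup.picToChow O) ↔
      ∀ p : MaximalSpectrum O,
        Subsingleton (ChowGroup.Chow (Localization.AtPrime p.asIdeal))) ∧
    (Function.Injective (ChowGroup.picToChow O) ↔
      Function.Bijective (ClassGroup.extendedHom O (ChowGroup.Normalization O)) ∧
        (ChowGroup.pushforwardChow O).ker = ⊥) ∧
    (Function.Injective (ChowGroup.picToChow O) ↔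
      Function.Bijective (ClassGroup.extendedHom O (ChowGroup.Normalization O)) ∧
        (ChowGroup.pushforward O (ChowGroup.Normalization O)).ker.map
          (QuotientAddGroup.mk'
            (ChowGroup.principalDivisors (ChowGroup.Normalization O))) = ⊥) := by
  have h := ChowGroup.picToChow_injective_iff O hO
  exact ⟨ChowGroup.picToChow_surjective_iff O, h, ChowGroup.ker_pushforwardChow O ▸ h⟩
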